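/- **Setting.** For integers $1\le s\le d$ let $\mathbb V(s,d)=\{v\in\mathbb R^d:\|v\|_2=1,\ v\text{ has at most }s\text{ nonzero entries}\}$, and for a symmetric $d\times d$ matrix $M$ put $\lambda_{\max,s}(M)=\sup_{v\in\mathbb V(s,d)}v^{\sf T}Mv$, $\lambda_{\min,s}(M)=\inf_{v\in\mathbb V(s,d)}v^{\sf T}Mv$. Let $X_1,\dots,X_n$ be i.i.d. copies of $\Sigma_1^{1/2}U_1$ and $Y_1,\dots,Y_m$ i.i.d. copies of $\Sigma_2^{1/2}U_2$, the two samples being independent, where $\Sigma_1,\Sigma_2$ are positive semidefinite and, for $i=1,2$, $\mathbb E U_i=0$, $\mathbb E U_iU_i^{\sf T}=I_d$ and $\sup_{\|v\|_2=1}\|v^{\sf T}U_i\|_{\psi_2}\le L$; here $\|\cdot\|_{\psi_2}$ is the Orlicz norm for $\psi_2(x)=e^{x^2}-1$. Write $\mathbb P_{(\Sigma_1,\Sigma_2)}$ for the law of the data, and $\hat\Sigma_1=n^{-1}\sum_iX_iX_i^{\sf T}$, $\hat\Sigma_2=m^{-1}\sum_iY_iY_i^{\sf T}$. For matrices $D,B_1,B_2$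 put $$N(D;B_1,B_2)=\sqrt{\tfrac{n+m}{nm}}\ \sup_{v\in\mathbb V(s,d)}\left|\frac{v^{\sf T}Dv}{v^{\sf T}(B_1/n+B_2/m)v}\right|\qquad(\text{with }0/0=0),$$ and define $$\hat{\mathcal Q}_{\max}=N(\hat\Sigma_1-\hat\Sigma_2;\hat\Sigma_1,\hat\Sigma_2),\qquad \hat{\mathcal B}_{\max}=N\Big(\tfrac1n\sum_{i=1}^n\xi_i(X_iX_i^{\sf T}-\hat\Sigma_1)-\tfrac1m\sum_{i=1}^m\eta_i(Y_iY_i^{\sf T}-\hat\Sigma_2);\hat\Sigma_1,\hat\Sigma_2\Big),$$ where $\xi_1,\dots,\xi_n,\eta_1,\dots,\eta_m$ are independent standard Gaussian variables, independent of the data. Let $q_\alpha$ be the $(1-\alpha)$-quantile of the conditional distribution of $\hat{\mathcal B}_{\max}$ given the data, and let $T_\alpha=\mathbf 1(\hat{\mathcal Q}_{\max}\ge q_\alpha)$. For $\lambda>0$ and a constant $C\ge1$, let $\mathbb M(\lambda)$ be the set of pairs $(M_1,M_2)$ of positive semidefinite $d\times d$ matrices with $\lambda_{\min,s}(M_\ell)>0$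 and $\lambda_{\max,s}(M_\ell)/\lambda_{\min,s}(M_\ell)\le C$ for $\ell=1,2$, and $N(M_1-M_2;M_1,M_2)\ge\lambda\sqrt{s\log(ed/s)}$. **Theorem.** Fix $\alpha\in(0,1)$, $C\ge1$, $L\ge 0$ and $\kappa\in\mathbb R$. Consider sequences $m=m_n$, $d=d_n$, $s=s_n$ with $1\le s\le d$, with $n\le\kappa m$ and $m\le\kappa n$ for all large $n$, and with $s\log(ed/s)\log n=o(n)$, and laws of $U_1,U_2$ (which may change with $n$) as above, with the same $L$ for every $n$. 1. There is $\lambda_0>0$, depending only on $(\alpha,C,L,\kappa)$, such that for every $\lambda\ge\lambda_0$ and all such sequences and laws with $d\to\infty$, $$\inf_{(\Sigma_1,\Sigma_2)\in\mathbb M(\lambda)}\mathbb P_{(\Sigma_1,\Sigma_2)}(T_\alpha=1)\to1\qquad\text{as }n\to\infty .$$ 2. Without the condition $d\to\infty$: for every $\varepsilon>0$ there is $\lambda_0>0$, depending only on $(\varepsilon,\alpha,C,L,\kappa)$, such that for every $\lambda\ge\lambda_0$ and all such sequences and laws, $$\inf_{(\Sigma_1,\Sigma_2)\in\mathbb M(\lambda)}\mathbb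 P_{(\Sigma_1,\Sigma_2)}(T_\alpha=1)\ge1-\varepsilon\qquad\text{for all sufficiently large }n .$$ -/

import Mathlib

open MeasureTheory ProbabilityTheory Filter Topology Asymptotics
open scoped ENNReal NNReal Matrix MatrixOrder

namespace SparseRoy

/-- `𝕍(s,d)`: the vectors of Euclidean norm one in `ℝ^d` with at most `s` nonzero entries. -/
def sparseSphere (s d : ℕ) : Set (Fin d → ℝ) :=
  {v | ∑ j, v j ^ 2 = 1 ∧ (Finset.univ.filter fun j => v j ≠ 0).card ≤ s}

/-- The quadratic form `vᵀ M v`. -/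
def quadForm {d : ℕ} (M : Matrix (Fin d) (Fin d) ℝ) (v : Fin d → ℝ) : ℝ :=
  v ⬝ᵥ (M *ᵥ v)

/-- The `s`-sparse largest eigenvalue `λ_{max,s}(M)`. -/
noncomputable def sparseMaxEig {d : ℕ} (s : ℕ) (M : Matrix (Fin d) (Fin d) ℝ) : ℝ :=
  ⨆ v : sparseSphere s d, quadForm M v

/-- The `s`-sparse smallest eigenvalue `λ_{min,s}(M)`. -/
noncomputable def sparseMinEig {d : ℕ} (s : ℕ) (M : Matrix (Fin d) (Fin d) ℝ) : ℝ :=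
  ⨅ v : sparseSphere s d, quadForm M v

/-- `√((n+m)/(nm)) · sup_{v ∈ 𝕍(s,d)} |vᵀ D v / vᵀ (B₁/n + B₂/m) v|`.
In every use below `|vᵀ D v|` is at most a constant (independent of `v`) times the denominator, so
the supremum is over a bounded set, and a vanishing denominator contributes `0/0 = 0`. -/
noncomputable def normalizedSup {d : ℕ} (s n m : ℕ) (D B₁ B₂ : Matrix (Fin d) (Fin d) ℝ) : ℝ :=
  ⨆ v : sparseSphere s d,
    |√(((n : ℝ) + m) / (n * m)) *
      (quadForm D v / quadForm ((n : ℝ)⁻¹ • B₁ + (m : ℝ)⁻¹ • B₂) v)|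

/-- The sample covariance matrix `n⁻¹ ∑ᵢ xᵢ xᵢᵀ` (the mean is known to be zero). -/
noncomputable def sampleCov {n d : ℕ} (x : Fin n → Fin d → ℝ) : Matrix (Fin d) (Fin d) ℝ :=
  (n : ℝ)⁻¹ • ∑ i, Matrix.vecMulVec (x i) (x i)

/-- The multiplier version `n⁻¹ ∑ᵢ ξᵢ (xᵢ xᵢᵀ - Σ̂)` of the centred sample covariance matrix. -/
noncomputable def multiplierCov {n d : ℕ} (x : Fin n → Fin d → ℝ) (ξ : Fin n → ℝ) :
    Matrix (Fin d) (Fin d) ℝ :=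
  (n : ℝ)⁻¹ • ∑ i, ξ i • (Matrix.vecMulVec (x i) (x i) - sampleCov x)

/-- The test statistic: the normalized `s`-sparse largest singular value of `Σ̂₁ - Σ̂₂`. -/
noncomputable def statQ {n m d : ℕ} (s : ℕ) (x : Fin n → Fin d → ℝ) (y : Fin m → Fin d → ℝ) : ℝ :=
  normalizedSup s n m (sampleCov x - sampleCov y) (sampleCov x) (sampleCov y)

/-- The multiplier bootstrap statistic, for given data `x, y` and multipliers `ξ, η`. -/
noncomputable def statB {n m d : ℕ} (s : ℕ) (x : Fin n → Fin d → ℝ) (y : Fin m → Fin d → ℝ)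
    (ξ : Fin n → ℝ) (η : Fin m → ℝ) : ℝ :=
  normalizedSup s n m (multiplierCov x ξ - multiplierCov y η) (sampleCov x) (sampleCov y)

/-- The law of `n + m` independent standard Gaussian multipliers. -/
noncomputable def multiplierLaw (n m : ℕ) : Measure ((Fin n → ℝ) × (Fin m → ℝ)) :=
  (Measure.pi fun _ => gaussianReal 0 1).prod (Measure.pi fun _ => gaussianReal 0 1)

/-- `q_α`: the `(1-α)`-quantile of the exact conditional law of the bootstrap statistic given the
data `x, y`. The multipliers are independent of the data, so this is the law of `statB` with the
data held fixed. -/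
noncomputable def bootstrapQuantile {n m d : ℕ} (α : ℝ) (s : ℕ) (x : Fin n → Fin d → ℝ)
    (y : Fin m → Fin d → ℝ) : ℝ :=
  sInf {t : ℝ | ENNReal.ofReal (1 - α) ≤ multiplierLaw n m {w | statB s x y w.1 w.2 ≤ t}}

open Classical in
/-- The test `T_α`, equal to `1` exactly when the null hypothesis is rejected. -/
noncomputable def test {n m d : ℕ} (α : ℝ) (s : ℕ) (x : Fin n → Fin d → ℝ)
    (y : Fin m → Fin d → ℝ) : ℕ :=
  if bootstrapQuantile α s x y ≤ statQ s x y then 1 else 0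

/-- The Orlicz norm of `f` under `μ` for `ψ₂(x) = exp(x²) - 1`, with value `∞` if no constant
`c` satisfies `E ψ₂(f/c) ≤ 1`. -/
noncomputable def psi2Norm {Ω : Type*} [MeasurableSpace Ω] (f : Ω → ℝ) (μ : Measure Ω) : ℝ≥0∞ :=
  ⨅ (c : ℝ≥0) (_ : 0 < c ∧ ∫⁻ ω, ENNReal.ofReal (Real.exp ((f ω / c) ^ 2) - 1) ∂μ ≤ 1), (c : ℝ≥0∞)

/-- `P` is the law of a random vector `U` in `ℝ^d` with `E U = 0`, `E U Uᵀ = I` and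
`sup_{‖v‖₂ = 1} ‖vᵀ U‖_{ψ₂} ≤ L`. -/
structure IsSubGaussianLaw {d : ℕ} (L : ℝ≥0) (P : Measure (Fin d → ℝ)) : Prop where
  isProbabilityMeasure : IsProbabilityMeasure P
  mean : ∀ j, ∫ u, u j ∂P = 0
  cov : ∀ j k, ∫ u, u j * u k ∂P = (1 : Matrix (Fin d) (Fin d) ℝ) j k
  psi2 : ⨆ v ∈ {v : Fin d → ℝ | ∑ j, v j ^ 2 = 1}, psi2Norm (fun u => v ⬝ᵥ u) P ≤ L

/-- The law of the data: `X₁,…,Xₙ,Y₁,…,Yₘ` are independent, each `Xᵢ` is distributed as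
`Σ₁^{1/2} U₁` with `U₁ ∼ P₁` and each `Yᵢ` as `Σ₂^{1/2} U₂` with `U₂ ∼ P₂`. -/
noncomputable def dataLaw {d : ℕ} (n m : ℕ) (P₁ P₂ : Measure (Fin d → ℝ))
    (S₁ S₂ : Matrix (Fin d) (Fin d) ℝ) : Measure ((Fin n → Fin d → ℝ) × (Fin m → Fin d → ℝ)) :=
  (Measure.pi fun _ => P₁.map fun u => CFC.sqrt S₁ *ᵥ u).prod
    (Measure.pi fun _ => P₂.map fun u => CFC.sqrt S₂ *ᵥ u)

/-- The alternative class `𝕄(λ)` of pairs of covariance matrices: the `s`-sparse condition numbers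
are (well defined and) at most `C`, and the normalized `s`-sparse spectral gap is at least
`λ √(s log(ed/s))`. -/
def altClass {d : ℕ} (C lam : ℝ) (s n m : ℕ) :
    Set (Matrix (Fin d) (Fin d) ℝ × Matrix (Fin d) (Fin d) ℝ) :=
  {M | (M.1.PosSemidef ∧ 0 < sparseMinEig s M.1 ∧ sparseMaxEig s M.1 / sparseMinEig s M.1 ≤ C) ∧
    (M.2.PosSemidef ∧ 0 < sparseMinEig s M.2 ∧ sparseMaxEig s M.2 / sparseMinEig s M.2 ≤ C) ∧
    lam * √(s * Real.log (Real.exp 1 * d / s)) ≤ normalizedSup s n m (M.1 - M.2) M.1 M.2}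

/-- The worst-case power `inf_{(Σ₁,Σ₂) ∈ 𝕄(λ)} P_{(Σ₁,Σ₂)}(T_α = 1)` of the test. -/
noncomputable def worstPower {d : ℕ} (α C lam : ℝ) (s n m : ℕ) (P₁ P₂ : Measure (Fin d → ℝ)) :
    ℝ≥0∞ :=
  ⨅ S ∈ altClass (d := d) C lam s n m, dataLaw n m P₁ P₂ S.1 S.2 {z | test α s z.1 z.2 = 1}

end SparseRoy

/-! Write k = s log(ed/s). All errors are measured relative to the population quadratic forms.
Suppose that on the sparse sphere the form of each sample covariance has relative error at most δ₁
(resp. δ₂), both at most 1/2, and that, given the data, each multiplier form is at most 3δ₁ (resp.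
3δ₂) times the population form except with probability α/2. Put r = √((n+m)/(nm)) (δ₁n + δ₂m).
Sample and population denominators are then comparable, so the bootstrap quantile is at most 6r,
while N(Σ₁-Σ₂) ≤ (3/2) Q + r for the statistic Q. A gap of 10r therefore forces rejection. With δ of
order √(k/n) and balanced samples, r is of order √k, which is the separation in the alternative
class. No limit law is needed.

The relative errors come from a net. The square root of Σ maps the sparse sphere into C(d,s)
subspaces of dimension at most s, and nets of their unit spheres have together at most exp(3k)
points. At a net point w one needs a bound for ∑ aᵢ((w·Uᵢ)² - 1), with a = 1 for the sample
covariance and a = ξ for its multiplier version. For fixed a this is a Chernoff bound for centred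
squares of sub-Gaussian variables. Outside an event of probability O(1/n) the multipliers are at
most 2√(log n) and have sum of squares at most 4n; the growth condition k log n = o(n) is what keeps
the Chernoff parameter admissible. Fubini and Markov turn the bound for fixed multipliers into one
for the conditional law given the data (`measure_not_regularSample_le`).

A sample fails to be regular with probability O(exp(-Ak) + 1/n), where A grows with λ. Since k ≥ 1 +
log d, this vanishes when d tends to infinity; otherwise k ≥ 1 and a large A make it small. -/

namespace SparseRoy

/-! ### Nets on spheres and quadratic forms -/

section Net

variable {E : Type*} [NormedAddCommGroup E] [InnerProductSpace ℝ E]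

/-- Doubling the points gives a 1-separated set in the ball of radius 2, the packing problem of
`Besicovitch.card_le_of_separated`. -/
theorem card_le_of_half_separated [FiniteDimensional ℝ E] (N : Finset E) (h₁ : ∀ u ∈ N, ‖u‖ = 1)
    (h₂ : ∀ u ∈ N, ∀ v ∈ N, u ≠ v → 1 / 2 ≤ ‖u - v‖) : N.card ≤ 5 ^ Module.finrank ℝ E := by
  classical
  have hinj : Function.Injective fun u : E => (2 : ℝ) • u :=
    smul_right_injective E (two_ne_zero' ℝ)
  rw [← Finset.card_image_of_injective N hinj]
  refine Besicovitch.card_le_of_separated _ ?_ ?_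
  · intro c hc
    obtain ⟨u, hu, rfl⟩ := Finset.mem_image.1 hc
    simp [norm_smul, h₁ u hu]
  · intro c hc c' hc' hne
    obtain ⟨u, hu, rfl⟩ := Finset.mem_image.1 hc
    obtain ⟨v, hv, rfl⟩ := Finset.mem_image.1 hc'
    have huv : u ≠ v := fun h => hne (by rw [h])
    have := h₂ u hu v hv huv
    rw [← smul_sub, norm_smul, Real.norm_ofNat]
    linarith

/-- A half-separated set of maximal cardinality is a net, since an uncovered unit vector could be
added to it. -/
theorem exists_sphere_net (E : Type*) [NormedAddCommGroup E] [InnerProductSpace ℝ E]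
    [FiniteDimensional ℝ E] :
    ∃ N : Finset E, N.card ≤ 5 ^ Module.finrank ℝ E ∧ (∀ u ∈ N, ‖u‖ = 1) ∧
      ∀ v : E, ‖v‖ = 1 → ∃ u ∈ N, ‖v - u‖ < 1 / 2 := by
  classical
  let A : Set ℕ := {c | ∃ N : Finset E, N.card = c ∧ (∀ u ∈ N, ‖u‖ = 1) ∧
    ∀ u ∈ N, ∀ v ∈ N, u ≠ v → 1 / 2 ≤ ‖u - v‖}
  have hA : A.Nonempty := ⟨0, ∅, by simp⟩
  have hbdd : BddAbove A := ⟨5 ^ Module.finrank ℝ E, by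
    rintro c ⟨N, rfl, h₁, h₂⟩
    exact card_le_of_half_separated N h₁ h₂⟩
  obtain ⟨N, hN, h₁, h₂⟩ := Nat.sSup_mem hA hbdd
  refine ⟨N, card_le_of_half_separated N h₁ h₂, h₁, fun v hv => ?_⟩
  by_contra! hcon
  have hvN : v ∉ N := fun h => by
    have := hcon v h
    norm_num at this
  have hmem : N.card + 1 ∈ A := by
    refine ⟨insert v N, Finset.card_insert_of_notMem hvN, ?_, ?_⟩
    · intro u hu
      rcases Finset.mem_insert.1 hu with rfl | hu
      · exact hv
      · exact h₁ u hu
    · intro u hu w hw hne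
      rcases Finset.mem_insert.1 hu with rfl | hu <;> rcases Finset.mem_insert.1 hw with rfl | hw
      · exact absurd rfl hne
      · exact hcon w hw
      · rw [norm_sub_rev]; exact hcon u ‹_›
      · exact h₂ u hu w hw hne
  have := le_csSup hbdd hmem
  omega

/-- Polarization combined with the parallelogram law; normalizing both vectors then gives the
product form `abs_bilin_le`. -/
theorem abs_bilin_le_of_norm_le (B : E →ₗ[ℝ] E →ₗ[ℝ] ℝ) (hB : ∀ x y, B x y = B y x) {S : ℝ}
    (hS : ∀ x, |B x x| ≤ S * ‖x‖ ^ 2) (x y : E) : |B x y| ≤ S * ((‖x‖ ^ 2 + ‖y‖ ^ 2) / 2) := by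
  have h₁ := abs_le.1 (hS (x + y))
  have h₂ := abs_le.1 (hS (x - y))
  have hp := parallelogram_law_with_norm ℝ x y
  have e₁ : B (x + y) (x + y) = B x x + 2 * B x y + B y y := by
    simp only [map_add, LinearMap.add_apply, hB y x]; ring
  have e₂ : B (x - y) (x - y) = B x x - 2 * B x y + B y y := by
    simp only [map_sub, LinearMap.sub_apply, hB y x]; ring
  have h4 : S * ‖x + y‖ ^ 2 + S * ‖x - y‖ ^ 2 = 2 * S * (‖x‖ ^ 2 + ‖y‖ ^ 2) := by
    linear_combination S * hp
  rw [abs_le]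
  constructor <;> nlinarith [h₁.1, h₁.2, h₂.1, h₂.2]

theorem abs_bilin_le (B : E →ₗ[ℝ] E →ₗ[ℝ] ℝ) (hB : ∀ x y, B x y = B y x) {S : ℝ}
    (hS : ∀ x, |B x x| ≤ S * ‖x‖ ^ 2) (x y : E) : |B x y| ≤ S * (‖x‖ * ‖y‖) := by
  rcases eq_or_ne x 0 with rfl | hx
  · simp
  rcases eq_or_ne y 0 with rfl | hy
  · simp
  have hx' := norm_pos_iff.2 hx
  have hy' := norm_pos_iff.2 hy
  have h := abs_bilin_le_of_norm_le B hB hS (‖x‖⁻¹ • x) (‖y‖⁻¹ • y)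
  simp only [map_smul, LinearMap.smul_apply, smul_eq_mul, norm_smul, norm_inv, norm_norm,
    inv_mul_cancel₀ hx'.ne', inv_mul_cancel₀ hy'.ne'] at h
  rw [abs_mul, abs_mul, abs_of_pos (inv_pos.2 hx'), abs_of_pos (inv_pos.2 hy')] at h
  have h3 : ‖y‖⁻¹ * (‖x‖⁻¹ * |B x y|) = |B x y| / (‖x‖ * ‖y‖) := by field_simp
  rw [← div_le_iff₀ (by positivity)]
  rw [h3] at h
  linarith

/-- At a maximizer v of the form on the sphere, with net point u nearby, the difference of the
values is B(v-u, v+u), a fixed fraction below the maximum S. Hence S ≤ t + (31/32) S. -/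
theorem abs_bilin_self_le_of_net [FiniteDimensional ℝ E] (B : E →ₗ[ℝ] E →ₗ[ℝ] ℝ) (hB : ∀ x y, B x y = B y x)
    {N : Finset E} (hN : ∀ u ∈ N, ‖u‖ = 1) (hcov : ∀ v : E, ‖v‖ = 1 → ∃ u ∈ N, ‖v - u‖ < 1 / 2)
    {t : ℝ} (ht : ∀ u ∈ N, |B u u| ≤ t) (w : E) : |B w w| ≤ 32 * t * ‖w‖ ^ 2 := by
  rcases eq_or_ne w 0 with rfl | hw
  · simp
  have hw' := norm_pos_iff.2 hw
  have hcont : Continuous fun x : E => |B x x| := by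
    have : Continuous fun x : E => B x x := by
      have h : Continuous fun x : E => (LinearMap.toContinuousLinearMap
        ((LinearMap.toContinuousLinearMap : (E →ₗ[ℝ] ℝ) ≃ₗ[ℝ] (E →L[ℝ] ℝ)).toLinearMap ∘ₗ B)) x x :=
        by fun_prop
      exact h
    exact this.abs
  have hunit : ‖‖w‖⁻¹ • w‖ = 1 := by rw [norm_smul, norm_inv, norm_norm, inv_mul_cancel₀ hw'.ne']
  obtain ⟨v, hv, hmax⟩ := (isCompact_sphere (0 : E) 1).exists_isMaxOn
    ⟨_, mem_sphere_zero_iff_norm.2 hunit⟩ hcont.continuousOn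
  rw [mem_sphere_zero_iff_norm] at hv
  set S := |B v v| with hSdef
  have hS : ∀ x, |B x x| ≤ S * ‖x‖ ^ 2 := by
    intro x
    rcases eq_or_ne x 0 with rfl | hx
    · simp
    have hx' := norm_pos_iff.2 hx
    have h : |B (‖x‖⁻¹ • x) (‖x‖⁻¹ • x)| ≤ S := hmax (mem_sphere_zero_iff_norm.2
      (by rw [norm_smul, norm_inv, norm_norm, inv_mul_cancel₀ hx'.ne']))
    simp only [map_smul, LinearMap.smul_apply, smul_eq_mul] at h
    rw [abs_mul, abs_mul, abs_of_pos (inv_pos.2 hx')] at h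
    have h3 : ‖x‖⁻¹ * (‖x‖⁻¹ * |B x x|) = |B x x| / ‖x‖ ^ 2 := by field_simp
    rw [h3, div_le_iff₀ (by positivity)] at h
    exact h
  have hS0 : 0 ≤ S := abs_nonneg _
  obtain ⟨u, hu, huv⟩ := hcov v hv
  have hd : B v v - B u u = B (v - u) (v + u) := by
    simp only [map_add, map_sub, LinearMap.sub_apply, hB u v]; ring
  -- With r = ‖v - u‖² ≤ 1/4, the squared product is r(4 - r) ≤ 15/16 < (31/32)².
  have hprod : ‖v - u‖ * ‖v + u‖ ≤ 31 / 32 := by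
    have hp := parallelogram_law_with_norm ℝ v u
    rw [hv, hN u hu] at hp
    refine abs_le_of_sq_le_sq' ?_ (by norm_num) |>.2
    have h0 := norm_nonneg (v - u)
    have hlt : ‖v - u‖ * ‖v - u‖ ≤ 1 / 4 := by nlinarith
    have e : (‖v - u‖ * ‖v + u‖) ^ 2 =
        (‖v - u‖ * ‖v - u‖) * (4 - ‖v - u‖ * ‖v - u‖) := by
      have : ‖v + u‖ * ‖v + u‖ = 4 - ‖v - u‖ * ‖v - u‖ := by linarith
      rw [← this]; ring
    rw [e]
    have h1 : 0 ≤ ‖v - u‖ * ‖v - u‖ := by positivity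
    nlinarith
  have hb := abs_bilin_le B hB hS (v - u) (v + u)
  rw [← hd] at hb
  have h1 : S ≤ |B u u| + |B v v - B u u| := by
    have := abs_add_le (B u u) (B v v - B u u)
    rwa [add_sub_cancel] at this
  have h2 : S * (‖v - u‖ * ‖v + u‖) ≤ S * (31 / 32) := mul_le_mul_of_nonneg_left hprod hS0
  have hSt : S ≤ 32 * t := by linarith [ht u hu]
  exact (hS w).trans (mul_le_mul_of_nonneg_right hSt (by positivity))

end Net

/-! ### Quadratic forms and the sparse net -/

theorem quadForm_add {d : ℕ} (A B : Matrix (Fin d) (Fin d) ℝ) (v : Fin d → ℝ) :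
    quadForm (A + B) v = quadForm A v + quadForm B v := by
  simp [quadForm, Matrix.add_mulVec, dotProduct_add]

theorem quadForm_sub {d : ℕ} (A B : Matrix (Fin d) (Fin d) ℝ) (v : Fin d → ℝ) :
    quadForm (A - B) v = quadForm A v - quadForm B v := by
  simp [quadForm, Matrix.sub_mulVec, dotProduct_sub]

theorem quadForm_smul {d : ℕ} (a : ℝ) (A : Matrix (Fin d) (Fin d) ℝ) (v : Fin d → ℝ) :
    quadForm (a • A) v = a * quadForm A v := by
  simp [quadForm, Matrix.smul_mulVec]

theorem quadForm_sum {d : ℕ} {ι : Type*} (t : Finset ι) (A : ι → Matrix (Fin d) (Fin d) ℝ)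
    (v : Fin d → ℝ) : quadForm (∑ i ∈ t, A i) v = ∑ i ∈ t, quadForm (A i) v := by
  simp [quadForm, Matrix.sum_mulVec, dotProduct_sum]

theorem quadForm_vecMulVec {d : ℕ} (x v : Fin d → ℝ) :
    quadForm (Matrix.vecMulVec x x) v = (v ⬝ᵥ x) ^ 2 := by
  simp [quadForm, Matrix.vecMulVec_mulVec, dotProduct_comm x v, sq]

theorem quadForm_one {d : ℕ} (v : Fin d → ℝ) : quadForm 1 v = v ⬝ᵥ v := by
  simp [quadForm]

/-- A finite set of unit vectors which controls every quadratic form on the image of the sparse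
sphere under a linear map. -/
theorem exists_sparse_net {d s : ℕ} (hs : s ≤ d) (T : Matrix (Fin d) (Fin d) ℝ) :
    ∃ N : Finset (Fin d → ℝ), N.card ≤ d.choose s * 5 ^ s ∧ (∀ u ∈ N, u ⬝ᵥ u = 1) ∧
      ∀ A : Matrix (Fin d) (Fin d) ℝ, A.IsSymm → ∀ t : ℝ, (∀ u ∈ N, |quadForm A u| ≤ t) →
        ∀ v ∈ sparseSphere s d, |quadForm A (T *ᵥ v)| ≤ 32 * t * (T *ᵥ v ⬝ᵥ T *ᵥ v) := by
  classical
  -- The nets live in the images under `T` of the coordinate subspaces. This makes the final bound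
  -- relative to the squared norm of `T *ᵥ v`, and `T` need not be invertible.
  let F : Finset (Fin d) → Submodule ℝ (EuclideanSpace ℝ (Fin d)) := fun J =>
    Submodule.span ℝ ((J.image fun j => WithLp.toLp 2 (T *ᵥ Pi.single j 1) :
      Finset (EuclideanSpace ℝ (Fin d))) : Set (EuclideanSpace ℝ (Fin d)))
  have hF : ∀ J : Finset (Fin d), Module.finrank ℝ (F J) ≤ J.card := fun J =>
    (finrank_span_finset_le_card _).trans Finset.card_image_le
  have hsq : ∀ w : EuclideanSpace ℝ (Fin d), ‖w‖ ^ 2 = w.ofLp ⬝ᵥ w.ofLp := fun w => by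
    rw [EuclideanSpace.real_norm_sq_eq]; simp [dotProduct, sq]
  choose N hN₁ hN₂ hN₃ using fun J => exists_sphere_net (F J)
  refine ⟨(Finset.univ.powersetCard s).biUnion fun J => (N J).image fun u : F J => u.1.ofLp,
    ?_, ?_, ?_⟩
  · refine (Finset.card_biUnion_le_card_mul _ _ (5 ^ s) fun J hJ => ?_).trans (by simp)
    refine Finset.card_image_le.trans ((hN₁ J).trans ?_)
    exact Nat.pow_le_pow_right (by norm_num) ((hF J).trans (Finset.mem_powersetCard.1 hJ).2.le)
  · intro u hu
    obtain ⟨J, -, hu⟩ := Finset.mem_biUnion.1 hu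
    obtain ⟨w, hw, rfl⟩ := Finset.mem_image.1 hu
    have h : ‖(w : EuclideanSpace ℝ (Fin d))‖ = 1 := hN₂ J w hw
    rw [← hsq, h, one_pow]
  · intro A hA t ht v hv
    obtain ⟨J, hJ₁, hJ₂⟩ := Finset.exists_superset_card_eq hv.2 (by simpa using hs)
    have hmem : WithLp.toLp 2 (T *ᵥ v) ∈ F J := by
      have hsum : WithLp.toLp 2 (T *ᵥ v) = ∑ j, v j • WithLp.toLp 2 (T *ᵥ Pi.single j 1) := by
        ext i
        simp [Matrix.mulVec, dotProduct, mul_comm]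
      rw [hsum]
      refine Submodule.sum_mem _ fun j _ => ?_
      by_cases hj : v j = 0
      · simp [hj]
      · refine Submodule.smul_mem _ _ (Submodule.subset_span ?_)
        rw [Finset.mem_coe]
        exact Finset.mem_image_of_mem _ (hJ₁ (by simp [hj]))
    let ℓ : F J →ₗ[ℝ] (Fin d → ℝ) :=
      (WithLp.linearEquiv 2 ℝ (Fin d → ℝ)).toLinearMap ∘ₗ (F J).subtype
    have hquad : ∀ w w' : F J, (Matrix.toLinearMap₂' ℝ A).compl₁₂ ℓ ℓ w w' =
        (w : EuclideanSpace ℝ (Fin d)).ofLp ⬝ᵥ A *ᵥ (w' : EuclideanSpace ℝ (Fin d)).ofLp := by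
      intro w w'
      rw [LinearMap.compl₁₂_apply, Matrix.toLinearMap₂'_apply']
      rfl
    have key := abs_bilin_self_le_of_net ((Matrix.toLinearMap₂' ℝ A).compl₁₂ ℓ ℓ) (fun x y => by
        rw [hquad, hquad, Matrix.dotProduct_mulVec, ← Matrix.mulVec_transpose, hA.eq,
          dotProduct_comm]) (hN₂ J) (hN₃ J)
      (t := t) (fun u hu => by
        rw [hquad]
        exact ht _ (Finset.mem_biUnion.2 ⟨J, Finset.mem_powersetCard.2 ⟨J.subset_univ, hJ₂⟩,
          Finset.mem_image_of_mem _ hu⟩)) ⟨_, hmem⟩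
    rw [hquad] at key
    have hn : ‖(⟨WithLp.toLp 2 (T *ᵥ v), hmem⟩ : F J)‖ ^ 2 = T *ᵥ v ⬝ᵥ T *ᵥ v := hsq _
    rw [hn] at key
    exact key

/-! ### Sub-Gaussian moments and Chernoff bounds -/

theorem measurable_dotProduct_left {d : ℕ} (v : Fin d → ℝ) :
    Measurable fun u : Fin d → ℝ => v ⬝ᵥ u := by
  unfold dotProduct
  fun_prop

/-- The infimum defining `psi2Norm` may fail to be attained and may vanish. Passing to `L + 1`
leaves an admissible constant strictly below it, and also gives a scale of at least 1. -/
theorem lintegral_exp_sq_le {Ω : Type*} [MeasurableSpace Ω] {μ : Measure Ω}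
    [IsProbabilityMeasure μ] {f : Ω → ℝ} {L : ℝ≥0} (h : psi2Norm f μ ≤ L) :
    ∫⁻ ω, ENNReal.ofReal (Real.exp ((f ω / (L + 1)) ^ 2)) ∂μ ≤ 2 := by
  have hlt : psi2Norm f μ < (L + 1 : ℝ≥0) :=
    h.trans_lt (by exact_mod_cast lt_add_one L)
  simp only [psi2Norm, iInf_lt_iff] at hlt
  obtain ⟨c, ⟨hc, hint⟩, hcL⟩ := hlt
  have hcL' : (c : ℝ) ≤ L + 1 := by exact_mod_cast (ENNReal.coe_lt_coe.1 hcL).le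
  have hc' : (0 : ℝ) < c := by exact_mod_cast hc
  calc ∫⁻ ω, ENNReal.ofReal (Real.exp ((f ω / (L + 1)) ^ 2)) ∂μ
      ≤ ∫⁻ ω, (ENNReal.ofReal (Real.exp ((f ω / c) ^ 2) - 1) + 1) ∂μ := by
        refine lintegral_mono fun ω => ?_
        have h1 : (f ω / (L + 1)) ^ 2 ≤ (f ω / c) ^ 2 := by
          rw [div_pow, div_pow]
          gcongr
        have h2 := Real.one_le_exp (sq_nonneg (f ω / c))
        rw [← ENNReal.ofReal_one, ← ENNReal.ofReal_add (by linarith) zero_le_one]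
        exact ENNReal.ofReal_le_ofReal (by simpa using Real.exp_le_exp.2 h1)
    _ ≤ 2 := by
        rw [lintegral_add_right _ measurable_const]
        simp only [lintegral_const, measure_univ, mul_one]
        calc _ ≤ (1 : ℝ≥0∞) + 1 := by gcongr
          _ = 2 := one_add_one_eq_two

theorem integrable_exp_sq_of_psi2Norm_le {Ω : Type*} [MeasurableSpace Ω] {μ : Measure Ω}
    [IsProbabilityMeasure μ] {f : Ω → ℝ} (hf : Measurable f) {L : ℝ≥0} (h : psi2Norm f μ ≤ L) :
    Integrable (fun ω => Real.exp ((f ω / (L + 1)) ^ 2)) μ ∧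
      ∫ ω, Real.exp ((f ω / (L + 1)) ^ 2) ∂μ ≤ 2 := by
  have hl := lintegral_exp_sq_le h
  have hm : AEStronglyMeasurable (fun ω => Real.exp ((f ω / (L + 1)) ^ 2)) μ := by
    have : Measurable fun ω => Real.exp ((f ω / (L + 1)) ^ 2) := by fun_prop
    exact this.aestronglyMeasurable
  have h0 : 0 ≤ᵐ[μ] fun ω => Real.exp ((f ω / (L + 1)) ^ 2) :=
    ae_of_all _ fun ω => (Real.exp_pos _).le
  refine ⟨⟨hm, ?_⟩, ?_⟩
  · rw [hasFiniteIntegral_iff_ofReal h0]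
    exact hl.trans_lt ENNReal.ofNat_lt_top
  · rw [integral_eq_lintegral_of_nonneg_ae h0 hm]
    exact ENNReal.toReal_le_of_le_ofReal zero_le_two (by simpa using hl)

theorem exp_le_one_add_add_sq_mul_exp (x : ℝ) : Real.exp x ≤ 1 + x + x ^ 2 * Real.exp |x| := by
  have h := Complex.norm_exp_sub_sum_le_norm_mul_exp (x : ℂ) 2
  simp only [Finset.sum_range_succ, Finset.sum_range_zero, Nat.factorial, pow_zero, pow_one] at h
  rw [Complex.norm_real, Real.norm_eq_abs, sq_abs, ← Complex.ofReal_exp] at h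
  norm_num at h
  have h3 : ((Real.exp x : ℂ) - (1 + (x : ℂ))) = ((Real.exp x - (1 + x) : ℝ) : ℂ) := by push_cast; ring
  rw [← Complex.ofReal_exp, h3, Complex.norm_real, Real.norm_eq_abs] at h
  linarith [(abs_le.1 h).2]

/-- Moment generating function of the centred square of a random variable with a finite Gaussian
moment. -/
theorem exp_mul_sq_sub_one_le {c θ y : ℝ} (hc : 1 ≤ c) (hθ : |θ| * (2 * c ^ 2) ≤ 1) :
    Real.exp (θ * (y ^ 2 - 1)) ≤
      1 + θ * (y ^ 2 - 1) + 50 * c ^ 4 * θ ^ 2 * Real.exp ((y / c) ^ 2) := by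
  refine (exp_le_one_add_add_sq_mul_exp _).trans ?_
  gcongr 1 + θ * (y ^ 2 - 1) + ?_
  set W := (y / c) ^ 2 with hW
  have hc0 : 0 < c := by linarith
  have hy : y ^ 2 = c ^ 2 * W := by rw [hW]; field_simp
  have hW0 : 0 ≤ W := sq_nonneg _
  have hc2 : 1 ≤ c ^ 2 := one_le_pow₀ hc
  have h1 : |y ^ 2 - 1| ≤ c ^ 2 * (W + 1) := by
    rw [abs_le]; constructor <;> nlinarith
  have hθ0 := abs_nonneg θ
  have h2 : |θ * (y ^ 2 - 1)| ≤ (W + 1) / 2 := by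
    rw [abs_mul]
    have := mul_le_mul_of_nonneg_left h1 hθ0
    nlinarith
  have h3 : (θ * (y ^ 2 - 1)) ^ 2 ≤ θ ^ 2 * (c ^ 4 * (W + 1) ^ 2) := by
    rw [mul_pow]
    gcongr
    calc (y ^ 2 - 1) ^ 2 = |y ^ 2 - 1| ^ 2 := (sq_abs _).symm
      _ ≤ (c ^ 2 * (W + 1)) ^ 2 := by gcongr
      _ = _ := by ring
  -- The polynomial factor costs exp((W+1)/2) and the exponential remainder another exp((W+1)/2).
  -- Together they give e · exp W, and 16e < 50.
  have h4 : (W + 1) ^ 2 ≤ 16 * Real.exp ((W + 1) / 2) := by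
    have h5 : (W + 1) / 4 ≤ Real.exp ((W + 1) / 4) := by
      linarith [Real.add_one_le_exp ((W + 1) / 4)]
    have h6 : Real.exp ((W + 1) / 2) = Real.exp ((W + 1) / 4) ^ 2 := by
      rw [sq, ← Real.exp_add]; ring_nf
    rw [h6]
    have : (W + 1) ^ 2 = 16 * ((W + 1) / 4) ^ 2 := by ring
    rw [this]
    gcongr
  calc (θ * (y ^ 2 - 1)) ^ 2 * Real.exp |θ * (y ^ 2 - 1)|
      ≤ θ ^ 2 * (c ^ 4 * (16 * Real.exp ((W + 1) / 2))) * Real.exp ((W + 1) / 2) := by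
        gcongr
        exact h3.trans (by gcongr)
    _ = 16 * Real.exp 1 * (c ^ 4 * θ ^ 2 * Real.exp W) := by
        have : Real.exp ((W + 1) / 2) * Real.exp ((W + 1) / 2) = Real.exp 1 * Real.exp W := by
          rw [← Real.exp_add, ← Real.exp_add]; ring_nf
        linear_combination 16 * θ ^ 2 * c ^ 4 * this
    _ ≤ 50 * (c ^ 4 * θ ^ 2 * Real.exp W) := by
        gcongr
        linarith [Real.exp_one_lt_d9]
    _ = _ := by ring

namespace IsSubGaussianLaw

variable {d : ℕ} {L : ℝ≥0} {P : Measure (Fin d → ℝ)}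

theorem psi2Norm_le (hP : IsSubGaussianLaw L P) {v : Fin d → ℝ} (hv : v ⬝ᵥ v = 1) :
    psi2Norm (fun u => v ⬝ᵥ u) P ≤ L := by
  refine le_trans ?_ hP.psi2
  refine le_iSup₂ (f := fun (v : Fin d → ℝ) (_ : v ∈ {v : Fin d → ℝ | ∑ j, v j ^ 2 = 1}) =>
    psi2Norm (fun u => v ⬝ᵥ u) P) v ?_
  simpa [dotProduct, sq] using hv

theorem integrable_exp_sq (hP : IsSubGaussianLaw L P) {v : Fin d → ℝ} (hv : v ⬝ᵥ v = 1) :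
    Integrable (fun u => Real.exp ((v ⬝ᵥ u / (L + 1)) ^ 2)) P ∧
      ∫ u, Real.exp ((v ⬝ᵥ u / (L + 1)) ^ 2) ∂P ≤ 2 :=
  have := hP.isProbabilityMeasure
  integrable_exp_sq_of_psi2Norm_le (measurable_dotProduct_left v) (hP.psi2Norm_le hv)

theorem integrable_sq (hP : IsSubGaussianLaw L P) {v : Fin d → ℝ} (hv : v ⬝ᵥ v = 1) :
    Integrable (fun u => (v ⬝ᵥ u) ^ 2) P := by
  refine ((hP.integrable_exp_sq hv).1.const_mul (((L : ℝ) + 1) ^ 2)).mono'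
    ((measurable_dotProduct_left v).pow_const 2).aestronglyMeasurable (ae_of_all _ fun u => ?_)
  have hL : (0 : ℝ) < L + 1 := by positivity
  rw [Real.norm_eq_abs, abs_of_nonneg (sq_nonneg _)]
  have h := Real.add_one_le_exp ((v ⬝ᵥ u / (L + 1)) ^ 2)
  calc (v ⬝ᵥ u) ^ 2 = ((L : ℝ) + 1) ^ 2 * (v ⬝ᵥ u / (L + 1)) ^ 2 := by field_simp
    _ ≤ _ := by gcongr; linarith

theorem integrable_mul (hP : IsSubGaussianLaw L P) (j k : Fin d) :
    Integrable (fun u => u j * u k) P := by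
  have h : ∀ j : Fin d, Integrable (fun u : Fin d → ℝ => u j ^ 2) P := fun j => by
    have := hP.integrable_sq (v := Pi.single j 1) (by simp)
    simpa using this
  refine ((h j).add (h k)).mono' (by fun_prop) (ae_of_all _ fun u => ?_)
  rw [Real.norm_eq_abs, abs_mul]
  simp only [Pi.add_apply]
  nlinarith [sq_nonneg (|u j| - |u k|), sq_abs (u j), sq_abs (u k), abs_nonneg (u j), abs_nonneg (u k)]

theorem integral_sq (hP : IsSubGaussianLaw L P) {v : Fin d → ℝ} (hv : v ⬝ᵥ v = 1) :
    ∫ u, (v ⬝ᵥ u) ^ 2 ∂P = 1 := by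
  have h : ∀ u : Fin d → ℝ, (v ⬝ᵥ u) ^ 2 = ∑ j, ∑ k, (v j * v k) * (u j * u k) := fun u => by
    rw [sq, dotProduct, Finset.sum_mul_sum]
    refine Finset.sum_congr rfl fun j _ => Finset.sum_congr rfl fun k _ => by ring
  simp_rw [h]
  rw [integral_finsetSum _ fun j _ => integrable_finsetSum _ fun k _ =>
    (hP.integrable_mul j k).const_mul _]
  simp_rw [integral_finsetSum _ fun k _ => (hP.integrable_mul _ k).const_mul _,
    integral_const_mul, hP.cov, Matrix.one_apply]
  simpa [dotProduct] using hv

theorem integrable_exp_mul (hP : IsSubGaussianLaw L P) {v : Fin d → ℝ} (hv : v ⬝ᵥ v = 1) {θ : ℝ}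
    (hθ : |θ| * (2 * ((L : ℝ) + 1) ^ 2) ≤ 1) :
    Integrable (fun u => Real.exp (θ * ((v ⬝ᵥ u) ^ 2 - 1))) P ∧
      ∫ u, Real.exp (θ * ((v ⬝ᵥ u) ^ 2 - 1)) ∂P ≤ Real.exp (100 * ((L : ℝ) + 1) ^ 4 * θ ^ 2) := by
  have := hP.isProbabilityMeasure
  have hL : (1 : ℝ) ≤ L + 1 := by simp
  obtain ⟨hi, hle⟩ := hP.integrable_exp_sq hv
  have hsq := hP.integrable_sq hv
  have hcen : Integrable (fun u => 1 + θ * ((v ⬝ᵥ u) ^ 2 - 1)) P :=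
    (integrable_const _).add ((hsq.sub (integrable_const _)).const_mul _)
  have hexp := hi.const_mul (50 * ((L : ℝ) + 1) ^ 4 * θ ^ 2)
  have hb := hcen.add hexp
  have hm : Measurable fun u => Real.exp (θ * ((v ⬝ᵥ u) ^ 2 - 1)) := by
    have := measurable_dotProduct_left v
    fun_prop
  have hint : Integrable (fun u => Real.exp (θ * ((v ⬝ᵥ u) ^ 2 - 1))) P := by
    refine hb.mono' hm.aestronglyMeasurable (ae_of_all _ fun u => ?_)
    rw [Real.norm_eq_abs, Real.abs_exp]
    exact exp_mul_sq_sub_one_le hL hθ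
  refine ⟨hint, (integral_mono hint hb fun u => exp_mul_sq_sub_one_le hL hθ).trans ?_⟩
  have hsub : Integrable (fun u => (v ⬝ᵥ u) ^ 2 - 1) P := hsq.sub (integrable_const _)
  have hcen1 : ∫ u, (1 + θ * ((v ⬝ᵥ u) ^ 2 - 1)) ∂P = 1 := by
    rw [integral_add (integrable_const _) (hsub.const_mul _), integral_const_mul,
      integral_sub hsq (integrable_const _), hP.integral_sq hv]
    simp
  rw [integral_add' hcen hexp, hcen1, integral_const_mul]
  refine le_trans ?_ (Real.add_one_le_exp _)
  have : 50 * ((L : ℝ) + 1) ^ 4 * θ ^ 2 * ∫ u, Real.exp ((v ⬝ᵥ u / (L + 1)) ^ 2) ∂P ≤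
      50 * ((L : ℝ) + 1) ^ 4 * θ ^ 2 * 2 := by gcongr
  linarith

/-- Weighted Chernoff bound in a single direction. -/
theorem measure_weighted_sum_ge (hP : IsSubGaussianLaw L P) {v : Fin d → ℝ} (hv : v ⬝ᵥ v = 1)
    {n : ℕ} {a : Fin n → ℝ} {R V θ : ℝ} (hR : ∀ i, |a i| ≤ R) (hV : ∑ i, a i ^ 2 ≤ V)
    (hθ0 : 0 ≤ θ) (hθ : θ * R * (2 * ((L : ℝ) + 1) ^ 2) ≤ 1) (t : ℝ) :
    (Measure.pi fun _ : Fin n => P).real {x | t ≤ ∑ i, a i * ((v ⬝ᵥ x i) ^ 2 - 1)} ≤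
      Real.exp (100 * ((L : ℝ) + 1) ^ 4 * θ ^ 2 * V - θ * t) := by
  have := hP.isProbabilityMeasure
  have hθi : ∀ i, |θ * a i| * (2 * ((L : ℝ) + 1) ^ 2) ≤ 1 := fun i => by
    refine le_trans ?_ hθ
    rw [abs_mul, abs_of_nonneg hθ0]
    gcongr
    exact hR i
  have he : ∀ x : Fin n → Fin d → ℝ, Real.exp (θ * ∑ i, a i * ((v ⬝ᵥ x i) ^ 2 - 1)) =
      ∏ i, Real.exp (θ * a i * ((v ⬝ᵥ x i) ^ 2 - 1)) := fun x => by
    rw [← Real.exp_sum, Finset.mul_sum]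
    simp_rw [mul_assoc]
  have hint : Integrable (fun x : Fin n → Fin d → ℝ =>
      Real.exp (θ * ∑ i, a i * ((v ⬝ᵥ x i) ^ 2 - 1))) (Measure.pi fun _ => P) := by
    simp_rw [he]
    exact Integrable.fintype_prod
      (f := fun i (u : Fin d → ℝ) => Real.exp (θ * a i * ((v ⬝ᵥ u) ^ 2 - 1)))
      fun i => (hP.integrable_exp_mul hv (hθi i)).1
  refine (measure_ge_le_exp_mul_mgf t hθ0 hint).trans ?_
  have hmgf : mgf (fun x : Fin n → Fin d → ℝ => ∑ i, a i * ((v ⬝ᵥ x i) ^ 2 - 1))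
      (Measure.pi fun _ => P) θ ≤ Real.exp (100 * ((L : ℝ) + 1) ^ 4 * θ ^ 2 * V) := by
    unfold mgf
    simp_rw [he]
    rw [integral_fintype_prod_eq_prod
      (f := fun i (u : Fin d → ℝ) => Real.exp (θ * a i * ((v ⬝ᵥ u) ^ 2 - 1)))]
    calc _ ≤ ∏ i, Real.exp (100 * ((L : ℝ) + 1) ^ 4 * (θ * a i) ^ 2) :=
          Finset.prod_le_prod (fun i _ => integral_nonneg fun u => (Real.exp_pos _).le)
            fun i _ => (hP.integrable_exp_mul hv (hθi i)).2
      _ = Real.exp (100 * ((L : ℝ) + 1) ^ 4 * θ ^ 2 * ∑ i, a i ^ 2) := by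
          rw [← Real.exp_sum, Finset.mul_sum]
          congr 1
          exact Finset.sum_congr rfl fun i _ => by ring
      _ ≤ _ := by gcongr
  calc _ ≤ Real.exp (-θ * t) * Real.exp (100 * ((L : ℝ) + 1) ^ 4 * θ ^ 2 * V) := by gcongr
    _ = _ := by rw [← Real.exp_add]; ring_nf

theorem measure_weighted_abs_sum_ge (hP : IsSubGaussianLaw L P) {v : Fin d → ℝ} (hv : v ⬝ᵥ v = 1)
    {n : ℕ} {a : Fin n → ℝ} {R V θ : ℝ} (hR : ∀ i, |a i| ≤ R) (hV : ∑ i, a i ^ 2 ≤ V)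
    (hθ0 : 0 ≤ θ) (hθ : θ * R * (2 * ((L : ℝ) + 1) ^ 2) ≤ 1) (t : ℝ) :
    (Measure.pi fun _ : Fin n => P).real {x | t ≤ |∑ i, a i * ((v ⬝ᵥ x i) ^ 2 - 1)|} ≤
      2 * Real.exp (100 * ((L : ℝ) + 1) ^ 4 * θ ^ 2 * V - θ * t) := by
  have := hP.isProbabilityMeasure
  have h₁ := hP.measure_weighted_sum_ge hv hR hV hθ0 hθ t
  have h₂ := hP.measure_weighted_sum_ge hv (a := -a) (by simpa using hR) (by simpa using hV) hθ0 hθ t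
  have hsub : {x : Fin n → Fin d → ℝ | t ≤ |∑ i, a i * ((v ⬝ᵥ x i) ^ 2 - 1)|} ⊆
      {x | t ≤ ∑ i, a i * ((v ⬝ᵥ x i) ^ 2 - 1)} ∪
        {x | t ≤ ∑ i, (-a) i * ((v ⬝ᵥ x i) ^ 2 - 1)} := by
    intro x hx
    rcases le_abs.1 (show t ≤ |_| from hx) with h | h
    · exact Or.inl h
    · exact Or.inr (by simpa using h)
  refine (measureReal_mono hsub).trans ((measureReal_union_le _ _).trans ?_)
  linarith

end IsSubGaussianLaw

/-! ### Complexity of the sparse sphere and the union bound -/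

/-- The complexity `s log(ed/s)` of the sparse sphere. -/
noncomputable def sparseDim (s d : ℕ) : ℝ := s * Real.log (Real.exp 1 * d / s)

theorem sparseDim_eq {s d : ℕ} (hs : 1 ≤ s) (hsd : s ≤ d) :
    sparseDim s d = s * (1 + Real.log d - Real.log s) := by
  have hs' : (s : ℝ) ≠ 0 := by positivity
  have hd' : (d : ℝ) ≠ 0 := by have : 1 ≤ d := hs.trans hsd; positivity
  rw [sparseDim, Real.log_div (by positivity) hs', Real.log_mul (Real.exp_pos _).ne' hd',
    Real.log_exp]

theorem one_add_log_le_sparseDim {s d : ℕ} (hs : 1 ≤ s) (hsd : s ≤ d) :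
    1 + Real.log d ≤ sparseDim s d := by
  rw [sparseDim_eq hs hsd]
  have hs' : (1 : ℝ) ≤ s := by exact_mod_cast hs
  have h1 : Real.log s ≤ s - 1 := Real.log_le_sub_one_of_pos (by linarith)
  have h2 : Real.log s ≤ Real.log d := Real.log_le_log (by linarith) (by exact_mod_cast hsd)
  nlinarith

theorem one_le_sparseDim {s d : ℕ} (hs : 1 ≤ s) (hsd : s ≤ d) : 1 ≤ sparseDim s d := by
  have := one_add_log_le_sparseDim hs hsd
  have := Real.log_natCast_nonneg d
  linarith

theorem le_sparseDim {s d : ℕ} (hs : 1 ≤ s) (hsd : s ≤ d) : (s : ℝ) ≤ sparseDim s d := by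
  rw [sparseDim_eq hs hsd]
  have hs' : (1 : ℝ) ≤ s := by exact_mod_cast hs
  have h2 : Real.log s ≤ Real.log d := Real.log_le_log (by linarith) (by exact_mod_cast hsd)
  nlinarith

/-- The binomial coefficient is at most d^s/s! ≤ (ed/s)^s = exp k, and 5^s ≤ exp(2s) ≤ exp(2k). -/
theorem choose_mul_pow_le_exp {s d : ℕ} (hs : 1 ≤ s) (hsd : s ≤ d) :
    ((d.choose s * 5 ^ s : ℕ) : ℝ) ≤ Real.exp (3 * sparseDim s d) := by
  have hs' : (0 : ℝ) < s := by exact_mod_cast hs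
  have hd' : (0 : ℝ) < d := by exact_mod_cast hs.trans hsd
  have h1 : (d.choose s : ℝ) ≤ Real.exp (sparseDim s d) := by
    refine (Nat.choose_le_pow_div s d).trans ?_
    have h := Real.pow_div_factorial_le_exp (x := s) hs'.le s
    have hf : (0 : ℝ) < s.factorial := by positivity
    have hexp : Real.exp (sparseDim s d) = Real.exp s * d ^ s / s ^ s := by
      rw [sparseDim, mul_comm, Real.exp_mul, Real.exp_log (by positivity), Real.rpow_natCast,
        div_pow, mul_pow, ← Real.exp_nat_mul, mul_one]
    rw [hexp, div_le_div_iff₀ hf (by positivity)]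
    rw [div_le_iff₀ hf] at h
    calc (d : ℝ) ^ s * s ^ s ≤ d ^ s * (Real.exp s * s.factorial) := by gcongr
      _ = _ := by ring
  have h2 : (5 : ℝ) ^ s ≤ Real.exp (2 * sparseDim s d) := by
    have h5 : (5 : ℝ) ≤ Real.exp 2 := by
      have : Real.exp 2 = Real.exp 1 * Real.exp 1 := by rw [← Real.exp_add]; norm_num
      nlinarith [Real.exp_one_gt_d9]
    calc (5 : ℝ) ^ s ≤ Real.exp 2 ^ s := by gcongr
      _ = Real.exp (2 * s) := by rw [← Real.exp_nat_mul]; ring_nf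
      _ ≤ _ := by gcongr; exact le_sparseDim hs hsd
  push_cast
  calc (d.choose s : ℝ) * 5 ^ s ≤ Real.exp (sparseDim s d) * Real.exp (2 * sparseDim s d) := by
        gcongr
    _ = _ := by rw [← Real.exp_add]; ring_nf

/-- Union bound over the net, whose entropy accounts for the 3 in the exponent. The condition `hTR`
keeps the optimal Chernoff parameter in the range where the moment generating function is
controlled. -/
theorem IsSubGaussianLaw.measure_net_ge {d : ℕ} {L : ℝ≥0} {P : Measure (Fin d → ℝ)}
    (hP : IsSubGaussianLaw L P) {N : Finset (Fin d → ℝ)} (hN : ∀ u ∈ N, u ⬝ᵥ u = 1) {k : ℝ}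
    (hk : 0 ≤ k) (hcard : (N.card : ℝ) ≤ Real.exp (3 * k)) {n : ℕ} (hn : 1 ≤ n) {a : Fin n → ℝ}
    {R T : ℝ} (hT : 0 ≤ T) (haR : ∀ i, |a i| ≤ R) (ha : ∑ i, a i ^ 2 ≤ 4 * n)
    (hTR : T ^ 2 * R ^ 2 * k ≤ n) :
    (Measure.pi fun _ : Fin n => P) {x | ∃ u ∈ N, T * √(n * k) ≤ |∑ i, a i * ((u ⬝ᵥ x i) ^ 2 - 1)|} ≤
      ENNReal.ofReal (2 * Real.exp ((3 - T ^ 2 / (1600 * ((L : ℝ) + 1) ^ 4)) * k)) := by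
  have := hP.isProbabilityMeasure
  have hn' : (0 : ℝ) < n := by exact_mod_cast hn
  set c : ℝ := (L : ℝ) + 1 with hc
  have hc1 : 1 ≤ c := by simp [hc]
  have hc0 : 0 < c := by linarith
  set τ := T * √(n * k) with hτ
  have hτ0 : 0 ≤ τ := by positivity
  have hτ2 : τ ^ 2 = T ^ 2 * (n * k) := by rw [hτ, mul_pow, Real.sq_sqrt (by positivity)]
  -- The minimizer in θ of 100 c⁴ θ² (4n) - θτ, with value -τ²/(1600 c⁴ n).
  set θ := τ / (800 * c ^ 4 * n) with hθ
  have hτR : τ * R ≤ n := by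
    refine abs_le_of_sq_le_sq' ?_ hn'.le |>.2
    calc (τ * R) ^ 2 = (n : ℝ) * (T ^ 2 * R ^ 2 * k) := by rw [mul_pow, hτ2]; ring
      _ ≤ (n : ℝ) * n := by gcongr
      _ = (n : ℝ) ^ 2 := by ring
  have hθR : θ * R * (2 * c ^ 2) ≤ 1 := by
    have h1 : θ * R * (2 * c ^ 2) = (τ * R) / (400 * c ^ 2 * n) := by
      rw [hθ]; field_simp; ring
    rw [h1, div_le_one (by positivity)]
    have : 1 ≤ c ^ 2 := one_le_pow₀ hc1
    nlinarith
  have hexp : 100 * c ^ 4 * θ ^ 2 * (4 * n) - θ * τ = -(T ^ 2 / (1600 * c ^ 4)) * k := by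
    have h1 : 100 * c ^ 4 * θ ^ 2 * (4 * n) - θ * τ = - τ ^ 2 / (1600 * c ^ 4 * n) := by
      rw [hθ]; field_simp; ring
    rw [h1, hτ2]; field_simp
  have hu : ∀ u ∈ N, (Measure.pi fun _ : Fin n => P)
      {x | τ ≤ |∑ i, a i * ((u ⬝ᵥ x i) ^ 2 - 1)|} ≤
      ENNReal.ofReal (2 * Real.exp (-(T ^ 2 / (1600 * c ^ 4)) * k)) := fun u hu => by
    have h := hP.measure_weighted_abs_sum_ge (hN u hu) haR ha (by positivity : 0 ≤ θ) hθR τ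
    rw [← hc, hexp] at h
    exact (ENNReal.le_ofReal_iff_toReal_le (measure_ne_top _ _) (by positivity)).2 h
  have hset : {x : Fin n → Fin d → ℝ | ∃ u ∈ N, τ ≤ |∑ i, a i * ((u ⬝ᵥ x i) ^ 2 - 1)|} =
      ⋃ u ∈ N, {x | τ ≤ |∑ i, a i * ((u ⬝ᵥ x i) ^ 2 - 1)|} := by ext; simp
  rw [hset]
  refine (measure_biUnion_finset_le _ _).trans ((Finset.sum_le_sum hu).trans ?_)
  rw [Finset.sum_const, nsmul_eq_mul, ← ENNReal.ofReal_natCast,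
    ← ENNReal.ofReal_mul (Nat.cast_nonneg _)]
  refine ENNReal.ofReal_le_ofReal ?_
  calc (N.card : ℝ) * (2 * Real.exp (-(T ^ 2 / (1600 * c ^ 4)) * k))
      ≤ Real.exp (3 * k) * (2 * Real.exp (-(T ^ 2 / (1600 * c ^ 4)) * k)) := by gcongr
    _ = 2 * (Real.exp (3 * k) * Real.exp (-(T ^ 2 / (1600 * c ^ 4)) * k)) := by ring
    _ = _ := by rw [← Real.exp_add]; ring_nf

/-! ### Size of the Gaussian multipliers -/

section Gaussian

theorem gaussianReal_abs_gt_le {R : ℝ} (hR : 0 ≤ R) :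
    (gaussianReal 0 1).real {x | R < |x|} ≤ 2 * Real.exp (-R ^ 2 / 2) := by
  have h₁ := measure_ge_le_exp_mul_mgf (μ := gaussianReal 0 1) (X := id) R hR
    (integrable_exp_mul_gaussianReal R)
  have h₂ := measure_le_le_exp_mul_mgf (μ := gaussianReal 0 1) (X := id) (-R) (neg_nonpos.2 hR)
    (integrable_exp_mul_gaussianReal (-R))
  rw [mgf_id_gaussianReal] at h₁ h₂
  simp only [← Real.exp_add] at h₁ h₂
  have hsub : {x : ℝ | R < |x|} ⊆ {x | R ≤ id x} ∪ {x | id x ≤ -R} := by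
    intro x hx
    rcases lt_abs.1 (show R < |x| from hx) with h | h
    · exact Or.inl h.le
    · exact Or.inr (by simp only [Set.mem_ofPred_eq, id]; linarith)
  refine (measureReal_mono hsub).trans ((measureReal_union_le _ _).trans
    ((add_le_add h₁ h₂).trans (le_of_eq ?_)))
  norm_num
  ring_nf

/-- Multipliers whose maximum exceeds `2 √(log n)` or whose sum of squares exceeds `4 n`. -/
def largeMultipliers (n : ℕ) : Set (Fin n → ℝ) :=
  {ξ | (∃ i, 2 * √(Real.log n) < |ξ i|) ∨ 4 * n < ∑ i, ξ i ^ 2}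

theorem measurableSet_largeMultipliers (n : ℕ) : MeasurableSet (largeMultipliers n) := by
  have h : MeasurableSet {ξ : Fin n → ℝ | 4 * n < ∑ i, ξ i ^ 2} :=
    measurableSet_lt (by fun_prop) (by fun_prop)
  have h' : MeasurableSet {ξ : Fin n → ℝ | ∃ i, 2 * √(Real.log n) < |ξ i|} := by
    rw [Set.ofPred_exists]
    exact MeasurableSet.iUnion fun i => measurableSet_lt (by fun_prop) (by fun_prop)
  exact h'.union h

theorem integral_sq_gaussianReal : ∫ x, x ^ 2 ∂(gaussianReal 0 1) = 1 := by
  have h := variance_id_gaussianReal (μ := 0) (v := 1)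
  rw [variance_eq_sub (memLp_id_gaussianReal 2)] at h
  simpa using h

theorem memLp_sq_gaussianReal : MemLp (fun x : ℝ => x ^ 2) 2 (gaussianReal 0 1) := by
  have h := (memLp_id_gaussianReal (μ := 0) (v := 1) 4).norm_rpow_div 2
  have e : ((4 : ℝ≥0) : ℝ≥0∞) / 2 = 2 := by
    rw [show ((4 : ℝ≥0) : ℝ≥0∞) = 2 * 2 by norm_num]
    exact ENNReal.mul_div_cancel_right (by norm_num) (by norm_num)
  rw [e] at h
  simpa using h

/-- Each coordinate exceeds 2√(log n) with probability at most 2/n², so a union bound gives 2/n. The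
sum of squares has mean n and variance nV, so Chebyshev at distance n gives V/n. -/
theorem exists_measure_largeMultipliers_le : ∃ c : ℝ, 0 < c ∧ ∀ n : ℕ, 1 ≤ n →
    (Measure.pi fun _ : Fin n => gaussianReal 0 1) (largeMultipliers n) ≤ ENNReal.ofReal (c / n) := by
  set V := Var[fun x : ℝ => x ^ 2; gaussianReal 0 1] with hV
  have hV0 : 0 ≤ V := variance_nonneg _ _
  refine ⟨2 + V, by linarith, fun n hn => ?_⟩
  have hn' : (0 : ℝ) < n := by exact_mod_cast hn
  set γ := Measure.pi fun _ : Fin n => gaussianReal 0 1 with hγ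
  have h₁ : γ {ξ | ∃ i, 2 * √(Real.log n) < |ξ i|} ≤ ENNReal.ofReal (2 / n) := by
    rw [Set.ofPred_exists]
    refine (measure_iUnion_fintype_le _ _).trans ?_
    have hi : ∀ i, γ {ξ | 2 * √(Real.log n) < |ξ i|} ≤ ENNReal.ofReal (2 / n ^ 2) := fun i => by
      have hm := (measurePreserving_eval (fun _ : Fin n => gaussianReal 0 1) i).measure_preimage
        (s := {x | 2 * √(Real.log n) < |x|})
        (measurableSet_lt (by fun_prop) (by fun_prop)).nullMeasurableSet
      have h := gaussianReal_abs_gt_le (R := 2 * √(Real.log n)) (by positivity)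
      rw [mul_pow, Real.sq_sqrt (Real.log_natCast_nonneg n)] at h
      have he : 2 * Real.exp (-(2 ^ 2 * Real.log n) / 2) = 2 / (n : ℝ) ^ 2 := by
        have : -(2 ^ 2 * Real.log n) / 2 = -(((2 : ℕ) : ℝ) * Real.log n) := by push_cast; ring
        rw [this, Real.exp_neg, Real.exp_nat_mul, Real.exp_log hn']; rfl
      rw [he] at h
      refine (le_of_eq hm).trans ?_
      exact (ENNReal.le_ofReal_iff_toReal_le (measure_ne_top _ _) (by positivity)).2 h
    refine (Finset.sum_le_sum fun i _ => hi i).trans ?_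
    rw [Finset.sum_const, nsmul_eq_mul, Finset.card_univ, Fintype.card_fin,
      ← ENNReal.ofReal_natCast, ← ENNReal.ofReal_mul (Nat.cast_nonneg _)]
    refine ENNReal.ofReal_le_ofReal (le_of_eq ?_)
    field_simp
  have h₂ : γ {ξ | 4 * n < ∑ i, ξ i ^ 2} ≤ ENNReal.ofReal (V / n) := by
    have hmem : ∀ i : Fin n, MemLp (fun ξ : Fin n → ℝ => ξ i ^ 2) 2 γ := fun i =>
      memLp_sq_gaussianReal.comp_measurePreserving
        (measurePreserving_eval (fun _ : Fin n => gaussianReal 0 1) i)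
    have hvar : Var[∑ i, fun ξ : Fin n → ℝ => ξ i ^ 2; γ] = n * V := by
      rw [hγ, variance_sum_pi (X := fun _ x => x ^ 2) fun _ => memLp_sq_gaussianReal]
      simp [hV]
    have hmean : ∫ ξ, (∑ i, fun ξ : Fin n → ℝ => ξ i ^ 2) ξ ∂γ = n := by
      simp only [Finset.sum_apply]
      rw [integral_finsetSum _ fun i _ => (hmem i).integrable (by norm_num)]
      have : ∀ i : Fin n, ∫ ξ, ξ i ^ 2 ∂γ = 1 := fun i => by
        exact (integral_comp_eval (μ := fun _ : Fin n => gaussianReal 0 1) (i := i)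
          (f := fun x : ℝ => x ^ 2) (by fun_prop)).trans integral_sq_gaussianReal
      simp [this]
    have hch := meas_ge_le_variance_div_sq (μ := γ) (X := ∑ i, fun ξ : Fin n → ℝ => ξ i ^ 2)
      (memLp_finsetSum' _ fun i _ => hmem i) hn'
    rw [hmean, hvar] at hch
    have hq : (n : ℝ) * V / n ^ 2 = V / n := by field_simp
    rw [hq] at hch
    refine (measure_mono fun ξ hξ => ?_).trans hch
    simp only [Set.mem_ofPred_eq, Finset.sum_apply] at hξ ⊢
    exact le_trans (by linarith) (le_abs_self _)
  calc γ (largeMultipliers n) ≤ _ := measure_union_le _ _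
    _ ≤ _ := add_le_add h₁ h₂
    _ = _ := by rw [← ENNReal.ofReal_add (by positivity) (by positivity), add_div]

end Gaussian

/-! ### Regular samples -/

theorem sqrt_isSymm {d : ℕ} (S : Matrix (Fin d) (Fin d) ℝ) : (CFC.sqrt S).IsSymm := by
  have h : (CFC.sqrt S).PosSemidef := Matrix.nonneg_iff_posSemidef.1 (CFC.sqrt_nonneg S)
  simpa [Matrix.IsHermitian, Matrix.IsSymm, Matrix.conjTranspose_eq_transpose_of_trivial] using h.1

theorem dotProduct_sqrt_mulVec {d : ℕ} (S : Matrix (Fin d) (Fin d) ℝ) (v u : Fin d → ℝ) :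
    v ⬝ᵥ (CFC.sqrt S *ᵥ u) = (CFC.sqrt S *ᵥ v) ⬝ᵥ u := by
  rw [Matrix.dotProduct_mulVec, ← Matrix.mulVec_transpose, (sqrt_isSymm S).eq]

theorem sqrt_mulVec_dotProduct_self {d : ℕ} {S : Matrix (Fin d) (Fin d) ℝ} (hS : S.PosSemidef)
    (v : Fin d → ℝ) : (CFC.sqrt S *ᵥ v) ⬝ᵥ (CFC.sqrt S *ᵥ v) = quadForm S v := by
  rw [← dotProduct_sqrt_mulVec, Matrix.mulVec_mulVec,
    CFC.sqrt_mul_sqrt_self S (Matrix.nonneg_iff_posSemidef.2 hS), quadForm]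

theorem quadForm_sampleCov {n d : ℕ} (x : Fin n → Fin d → ℝ) (v : Fin d → ℝ) :
    quadForm (sampleCov x) v = (n : ℝ)⁻¹ * ∑ i, (v ⬝ᵥ x i) ^ 2 := by
  rw [sampleCov, quadForm_smul, quadForm_sum]
  simp_rw [quadForm_vecMulVec]

theorem quadForm_multiplierCov {n d : ℕ} (x : Fin n → Fin d → ℝ) (ξ : Fin n → ℝ)
    (v : Fin d → ℝ) : quadForm (multiplierCov x ξ) v =
      (n : ℝ)⁻¹ * ∑ i, ξ i * ((v ⬝ᵥ x i) ^ 2 - quadForm (sampleCov x) v) := by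
  rw [multiplierCov, quadForm_smul, quadForm_sum]
  simp_rw [quadForm_smul, quadForm_sub, quadForm_vecMulVec]

/-- A sample for which the sample covariance matrix has relative error at most `δ` on the sparse
sphere, and whose multiplier version is at most `3 δ` with conditional probability `1 - α / 2`. -/
def RegularSample {n d : ℕ} (α δ : ℝ) (s : ℕ) (S : Matrix (Fin d) (Fin d) ℝ)
    (x : Fin n → Fin d → ℝ) : Prop :=
  (∀ v ∈ sparseSphere s d, |quadForm (sampleCov x) v - quadForm S v| ≤ δ * quadForm S v) ∧
    (Measure.pi fun _ : Fin n => gaussianReal 0 1) {ξ | ∃ v ∈ sparseSphere s d,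
      3 * δ * quadForm S v < |quadForm (multiplierCov x ξ) v|} ≤ ENNReal.ofReal (α / 2)

/-- The matrix `∑ᵢ aᵢ (uᵢ uᵢᵀ - I)`. -/
def weightedCov {n d : ℕ} (a : Fin n → ℝ) (u : Fin n → Fin d → ℝ) : Matrix (Fin d) (Fin d) ℝ :=
  ∑ i, a i • (Matrix.vecMulVec (u i) (u i) - 1)

theorem weightedCov_isSymm {n d : ℕ} (a : Fin n → ℝ) (u : Fin n → Fin d → ℝ) :
    (weightedCov a u).IsSymm := by
  unfold Matrix.IsSymm weightedCov
  rw [Matrix.transpose_sum]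
  refine Finset.sum_congr rfl fun i _ => ?_
  rw [Matrix.transpose_smul, Matrix.transpose_sub, Matrix.transpose_vecMulVec,
    Matrix.transpose_one]

theorem quadForm_weightedCov {n d : ℕ} (a : Fin n → ℝ) (u : Fin n → Fin d → ℝ) (v : Fin d → ℝ) :
    quadForm (weightedCov a u) v = ∑ i, a i * ((v ⬝ᵥ u i) ^ 2 - v ⬝ᵥ v) := by
  rw [weightedCov, quadForm_sum]
  simp_rw [quadForm_smul, quadForm_sub, quadForm_vecMulVec, quadForm_one]

section Deterministic

variable {n d s : ℕ} {S : Matrix (Fin d) (Fin d) ℝ} {N : Finset (Fin d → ℝ)} {τ : ℝ}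
  {u : Fin n → Fin d → ℝ}

theorem abs_weighted_sum_le (hS : S.PosSemidef) (hN : ∀ u ∈ N, u ⬝ᵥ u = 1)
    (hnet : ∀ A : Matrix (Fin d) (Fin d) ℝ, A.IsSymm → ∀ t : ℝ, (∀ u ∈ N, |quadForm A u| ≤ t) →
      ∀ v ∈ sparseSphere s d, |quadForm A (CFC.sqrt S *ᵥ v)| ≤
        32 * t * (CFC.sqrt S *ᵥ v ⬝ᵥ CFC.sqrt S *ᵥ v))
    {a : Fin n → ℝ} (ha : ∀ w ∈ N, |∑ i, a i * ((w ⬝ᵥ u i) ^ 2 - 1)| ≤ τ) {v : Fin d → ℝ}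
    (hv : v ∈ sparseSphere s d) :
    |∑ i, a i * ((v ⬝ᵥ CFC.sqrt S *ᵥ u i) ^ 2 - quadForm S v)| ≤ 32 * τ * quadForm S v := by
  have h := hnet _ (weightedCov_isSymm a u) τ (fun w hw => by
    rw [quadForm_weightedCov, hN w hw]; exact ha w hw) v hv
  rw [quadForm_weightedCov, sqrt_mulVec_dotProduct_self hS] at h
  simpa only [dotProduct_sqrt_mulVec] using h

theorem abs_sampleCov_sub_le (hn : 1 ≤ n) (hS : S.PosSemidef) (hN : ∀ u ∈ N, u ⬝ᵥ u = 1)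
    (hnet : ∀ A : Matrix (Fin d) (Fin d) ℝ, A.IsSymm → ∀ t : ℝ, (∀ u ∈ N, |quadForm A u| ≤ t) →
      ∀ v ∈ sparseSphere s d, |quadForm A (CFC.sqrt S *ᵥ v)| ≤
        32 * t * (CFC.sqrt S *ᵥ v ⬝ᵥ CFC.sqrt S *ᵥ v))
    (h₁ : ∀ w ∈ N, |∑ i, ((w ⬝ᵥ u i) ^ 2 - 1)| ≤ τ) {v : Fin d → ℝ}
    (hv : v ∈ sparseSphere s d) :
    |quadForm (sampleCov fun i => CFC.sqrt S *ᵥ u i) v - quadForm S v| ≤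
      32 * τ / n * quadForm S v := by
  have hn' : (0 : ℝ) < n := by exact_mod_cast hn
  have h := abs_weighted_sum_le (a := 1) hS hN hnet (by simpa using h₁) hv
  simp only [Pi.one_apply, one_mul, Finset.sum_sub_distrib, Finset.sum_const, Finset.card_univ,
    Fintype.card_fin, nsmul_eq_mul] at h
  rw [quadForm_sampleCov]
  have e : (n : ℝ)⁻¹ * ∑ i, (v ⬝ᵥ CFC.sqrt S *ᵥ u i) ^ 2 - quadForm S v =
      (∑ i, (v ⬝ᵥ CFC.sqrt S *ᵥ u i) ^ 2 - n * quadForm S v) / n := by field_simp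
  rw [e, abs_div, abs_of_pos hn', div_mul_eq_mul_div]
  gcongr

theorem abs_multiplierCov_le (hn : 1 ≤ n) (hS : S.PosSemidef) (hN : ∀ u ∈ N, u ⬝ᵥ u = 1)
    (hnet : ∀ A : Matrix (Fin d) (Fin d) ℝ, A.IsSymm → ∀ t : ℝ, (∀ u ∈ N, |quadForm A u| ≤ t) →
      ∀ v ∈ sparseSphere s d, |quadForm A (CFC.sqrt S *ᵥ v)| ≤
        32 * t * (CFC.sqrt S *ᵥ v ⬝ᵥ CFC.sqrt S *ᵥ v))
    (h₁ : ∀ w ∈ N, |∑ i, ((w ⬝ᵥ u i) ^ 2 - 1)| ≤ τ) {ξ : Fin n → ℝ}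
    (hξ : ξ ∉ largeMultipliers n) (h₂ : ∀ w ∈ N, |∑ i, ξ i * ((w ⬝ᵥ u i) ^ 2 - 1)| ≤ τ)
    {v : Fin d → ℝ} (hv : v ∈ sparseSphere s d) :
    |quadForm (multiplierCov (fun i => CFC.sqrt S *ᵥ u i) ξ) v| ≤
      3 * (32 * τ / n) * quadForm S v := by
  have hn' : (0 : ℝ) < n := by exact_mod_cast hn
  have hsq : ∑ i, ξ i ^ 2 ≤ 4 * n := by
    by_contra hcon
    exact hξ (Or.inr (not_le.1 hcon))
  have hsum : |∑ i, ξ i| ≤ 2 * n := by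
    refine abs_le_of_sq_le_sq ?_ (by positivity)
    have h := sq_sum_le_card_mul_sum_sq (s := Finset.univ) (f := ξ)
    simp only [Finset.card_univ, Fintype.card_fin] at h
    nlinarith
  have hA := abs_sampleCov_sub_le hn hS hN hnet h₁ hv
  have hB := abs_weighted_sum_le hS hN hnet h₂ hv
  rw [quadForm_multiplierCov]
  set q := quadForm (sampleCov fun i => CFC.sqrt S *ᵥ u i) v
  -- Recentring at the population form leaves the correction (∑ ξᵢ)(q - vᵀSv). As |∑ ξᵢ| ≤ 2n by
  -- Cauchy–Schwarz, it adds twice the sample covariance error, whence the factor 1 + 2 = 3.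
  have e : ∑ i, ξ i * ((v ⬝ᵥ CFC.sqrt S *ᵥ u i) ^ 2 - q) =
      ∑ i, ξ i * ((v ⬝ᵥ CFC.sqrt S *ᵥ u i) ^ 2 - quadForm S v) -
        (∑ i, ξ i) * (q - quadForm S v) := by
    rw [Finset.sum_mul, ← Finset.sum_sub_distrib]
    exact Finset.sum_congr rfl fun i _ => by ring
  rw [e, abs_mul, abs_of_pos (inv_pos.2 hn')]
  calc _ ≤ (n : ℝ)⁻¹ * (32 * τ * quadForm S v + 2 * n * (32 * τ / n * quadForm S v)) := by
        gcongr
        refine (abs_sub _ _).trans (add_le_add hB ?_)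
        rw [abs_mul]
        gcongr
    _ = _ := by field_simp; ring

end Deterministic

/-- For fixed multipliers that are not large, the net bound controls the data. Exchanging the order
of integration bounds the mean over the data of the conditional bad probability, and Markov's
inequality at level α/2 produces the factor 2/α. -/
theorem IsSubGaussianLaw.measure_not_regularSample_le {α : ℝ} (hα₀ : 0 < α) (hα₁ : α < 1)
    {c : ℝ} (hc : ∀ n : ℕ, 1 ≤ n → (Measure.pi fun _ : Fin n => gaussianReal 0 1)
      (largeMultipliers n) ≤ ENNReal.ofReal (c / n)) (hc0 : 0 < c)
    {d s n : ℕ} {L : ℝ≥0} {P : Measure (Fin d → ℝ)}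
    (hP : IsSubGaussianLaw L P) {S : Matrix (Fin d) (Fin d) ℝ} (hS : S.PosSemidef) (hs : 1 ≤ s)
    (hsd : s ≤ d) (hn : 1 ≤ n) (hlog : 1 ≤ Real.log n) {T : ℝ} (hT : 0 ≤ T)
    (hTn : T ^ 2 * (4 * Real.log n) * sparseDim s d ≤ n) :
    (Measure.pi fun _ : Fin n => P) {u | ¬ RegularSample α (32 * T * √(sparseDim s d / n)) s S
      fun i => CFC.sqrt S *ᵥ u i} ≤
      ENNReal.ofReal (2 / α *
        (4 * Real.exp ((3 - T ^ 2 / (1600 * ((L : ℝ) + 1) ^ 4)) * sparseDim s d) + c / n)) := by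
  have := hP.isProbabilityMeasure
  have hn' : (0 : ℝ) < n := by exact_mod_cast hn
  set k := sparseDim s d with hk
  have hk0 : 0 ≤ k := zero_le_one.trans (one_le_sparseDim hs hsd)
  obtain ⟨N, hcard, hN, hnet⟩ := exists_sparse_net hsd (CFC.sqrt S)
  have hcard' : (N.card : ℝ) ≤ Real.exp (3 * k) :=
    le_trans (by exact_mod_cast hcard) (choose_mul_pow_le_exp hs hsd)
  set τ := T * √(n * k) with hτ
  have hδ : 32 * T * √(k / n) = 32 * τ / n := by
    have : √(n * k) = n * √(k / n) := by
      rw [show (n : ℝ) * k = n ^ 2 * (k / n) by field_simp, Real.sqrt_mul (by positivity),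
        Real.sqrt_sq hn'.le]
    rw [hτ, this]; field_simp
  rw [hδ]
  set p := 2 * Real.exp ((3 - T ^ 2 / (1600 * ((L : ℝ) + 1) ^ 4)) * k) with hp
  have hp0 : 0 < p := by positivity
  set μ := Measure.pi fun _ : Fin n => P with hμ
  set γ := Measure.pi fun _ : Fin n => gaussianReal 0 1 with hγ
  have hR : (2 * √(Real.log n)) ^ 2 = 4 * Real.log n := by
    rw [mul_pow, Real.sq_sqrt (by linarith)]; norm_num
  let D : (Fin n → ℝ) → Set (Fin n → Fin d → ℝ) := fun a =>
    {u | ∃ w ∈ N, τ ≤ |∑ i, a i * ((w ⬝ᵥ u i) ^ 2 - 1)|}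
  have h₁ : μ (D 1) ≤ ENNReal.ofReal p := by
    refine hP.measure_net_ge hN hk0 hcard' hn (a := 1) (R := 2 * √(Real.log n)) hT ?_ ?_ ?_
    · intro i
      have : 1 ≤ √(Real.log n) := Real.one_le_sqrt.2 hlog
      simp only [Pi.one_apply, abs_one]
      linarith
    · simp; linarith
    · rw [hR]; exact hTn
  have h₂ : ∀ ξ ∉ largeMultipliers n, μ (D ξ) ≤ ENNReal.ofReal p := by
    intro ξ hξ
    refine hP.measure_net_ge hN hk0 hcard' hn (R := 2 * √(Real.log n)) hT ?_ ?_ ?_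
    · intro i
      by_contra hcon
      exact hξ (Or.inl ⟨i, not_le.1 hcon⟩)
    · by_contra hcon
      exact hξ (Or.inr (not_le.1 hcon))
    · rw [hR]; exact hTn
  -- The bad event is expressed through the finite net, so that it is jointly measurable as Fubini
  -- requires; the event over the whole sparse sphere only has to lie inside it.
  let B : Set ((Fin n → Fin d → ℝ) × (Fin n → ℝ)) :=
    {z | z.2 ∈ largeMultipliers n} ∪ {z | z.1 ∈ D z.2}
  have hB : MeasurableSet B := by
    have hB₁ : MeasurableSet {z : (Fin n → Fin d → ℝ) × (Fin n → ℝ) | z.2 ∈ largeMultipliers n} :=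
      measurable_snd (measurableSet_largeMultipliers n)
    have hB₂ : {z : (Fin n → Fin d → ℝ) × (Fin n → ℝ) | z.1 ∈ D z.2} =
        ⋃ w ∈ N, {z | τ ≤ |∑ i, z.2 i * ((w ⬝ᵥ z.1 i) ^ 2 - 1)|} := by
      ext z; simp [D]
    refine hB₁.union ?_
    rw [hB₂]
    refine Finset.measurableSet_biUnion _ fun w _ => measurableSet_le measurable_const ?_
    have hw : ∀ i, Measurable fun z : (Fin n → Fin d → ℝ) × (Fin n → ℝ) => w ⬝ᵥ z.1 i := fun i =>
      (measurable_dotProduct_left w).comp (by fun_prop)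
    fun_prop
  have hprod : ∫⁻ u, γ (Prod.mk u ⁻¹' B) ∂μ ≤ ENNReal.ofReal (c / n + p) := by
    rw [← Measure.prod_apply hB, Measure.prod_apply_symm hB]
    calc ∫⁻ ξ, μ ((fun u => (u, ξ)) ⁻¹' B) ∂γ
        ≤ ∫⁻ ξ, ((largeMultipliers n).indicator 1 ξ + ENNReal.ofReal p) ∂γ := by
          refine lintegral_mono fun ξ => ?_
          by_cases hξ : ξ ∈ largeMultipliers n
          · rw [Set.indicator_of_mem hξ]
            exact prob_le_one.trans le_self_add
          · rw [Set.indicator_of_notMem hξ, zero_add]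
            refine (measure_mono fun u hu => ?_).trans (h₂ ξ hξ)
            exact hu.resolve_left hξ
      _ = γ (largeMultipliers n) + ENNReal.ofReal p := by
          rw [lintegral_add_right _ measurable_const,
            lintegral_indicator_one (measurableSet_largeMultipliers n)]
          simp
      _ ≤ ENNReal.ofReal (c / n) + ENNReal.ofReal p := by gcongr; exact hc n hn
      _ = _ := (ENNReal.ofReal_add (by positivity) hp0.le).symm
  have hmarkov : μ {u | ENNReal.ofReal (α / 2) ≤ γ (Prod.mk u ⁻¹' B)} ≤
      ENNReal.ofReal (2 / α * (c / n + p)) := by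
    have h := mul_meas_ge_le_lintegral (μ := μ) (measurable_measure_prodMk_left (ν := γ) hB)
      (ENNReal.ofReal (α / 2))
    have h' := h.trans hprod
    have e : c / n + p = α / 2 * (2 / α * (c / n + p)) := by field_simp
    rw [e, ENNReal.ofReal_mul (by positivity)] at h'
    exact (ENNReal.mul_le_mul_iff_right (by simpa using hα₀) ENNReal.ofReal_ne_top).1 h'
  have hsub : {u | ¬ RegularSample α (32 * τ / n) s S fun i => CFC.sqrt S *ᵥ u i} ⊆
      D 1 ∪ {u | ENNReal.ofReal (α / 2) ≤ γ (Prod.mk u ⁻¹' B)} := by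
    intro u hu
    by_contra hcon
    rw [Set.mem_union, not_or] at hcon
    have hu₁ : ∀ w ∈ N, |∑ i, ((w ⬝ᵥ u i) ^ 2 - 1)| ≤ τ := fun w hw => by
      by_contra hlt
      exact hcon.1 ⟨w, hw, by simpa using (not_le.1 hlt).le⟩
    refine hu ⟨fun v hv => abs_sampleCov_sub_le hn hS hN hnet hu₁ hv, ?_⟩
    refine le_trans (measure_mono fun ξ hξ => ?_) (not_le.1 hcon.2).le
    obtain ⟨v, hv, hlt⟩ := hξ
    by_contra hcon'
    rw [Set.mem_preimage, Set.mem_union, not_or] at hcon'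
    refine absurd (abs_multiplierCov_le hn hS hN hnet hu₁ hcon'.1 (fun w hw => ?_) hv)
      (not_le.2 hlt)
    by_contra hlt'
    exact hcon'.2 ⟨w, hw, (not_le.1 hlt').le⟩
  refine (measure_mono hsub).trans ((measure_union_le _ _).trans ((add_le_add h₁ hmarkov).trans ?_))
  rw [← ENNReal.ofReal_add hp0.le (by positivity)]
  refine ENNReal.ofReal_le_ofReal ?_
  have h2α : 1 ≤ 2 / α := by rw [le_div_iff₀ hα₀]; linarith
  have : p ≤ 2 / α * p := by nlinarith
  calc p + 2 / α * (c / n + p) ≤ 2 / α * p + 2 / α * (c / n + p) := by gcongr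
    _ = _ := by rw [hp]; ring

theorem sparseSphere_nonempty {s d : ℕ} (hs : 1 ≤ s) (hsd : s ≤ d) : (sparseSphere s d).Nonempty := by
  classical
  refine ⟨Pi.single ⟨0, hs.trans hsd⟩ 1, by simp [Pi.single_apply], ?_⟩
  refine le_trans ?_ hs
  refine (Finset.card_le_card (t := {⟨0, hs.trans hsd⟩}) fun j hj => ?_).trans_eq
    (Finset.card_singleton _)
  by_contra hne
  rw [Finset.mem_singleton] at hne
  simp [Pi.single_apply, hne] at hj

theorem quadForm_nonneg {d : ℕ} {S : Matrix (Fin d) (Fin d) ℝ} (hS : S.PosSemidef)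
    (v : Fin d → ℝ) : 0 ≤ quadForm S v := by
  rw [← sqrt_mulVec_dotProduct_self hS]
  exact Finset.sum_nonneg fun i _ => mul_self_nonneg _

theorem quadForm_pos_of_sparseMinEig_pos {d s : ℕ} {S : Matrix (Fin d) (Fin d) ℝ}
    (hS : S.PosSemidef) (h : 0 < sparseMinEig s S) {v : Fin d → ℝ} (hv : v ∈ sparseSphere s d) :
    0 < quadForm S v := by
  refine h.trans_le (ciInf_le (f := fun v : sparseSphere s d => quadForm S v) ⟨0, ?_⟩ ⟨v, hv⟩)
  rintro _ ⟨w, rfl⟩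
  exact quadForm_nonneg hS _

/-! ### Deterministic comparison of the statistic with the bootstrap quantile -/

section TwoSample

variable {n m d s : ℕ} {α δ₁ δ₂ : ℝ} {S₁ S₂ : Matrix (Fin d) (Fin d) ℝ}
  {x : Fin n → Fin d → ℝ} {y : Fin m → Fin d → ℝ}

theorem quadForm_pooled (A B : Matrix (Fin d) (Fin d) ℝ) (v : Fin d → ℝ) :
    quadForm ((n : ℝ)⁻¹ • A + (m : ℝ)⁻¹ • B) v = quadForm A v / n + quadForm B v / m := by
  rw [quadForm_add, quadForm_smul, quadForm_smul, inv_mul_eq_div, inv_mul_eq_div]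

/-- Expanding the product leaves nonnegative cross terms. This converts relative errors of the two
samples into a multiple of the pooled denominator. -/
theorem weighted_add_le (hn : 1 ≤ n) (hm : 1 ≤ m) (hδ₁ : 0 ≤ δ₁) (hδ₂ : 0 ≤ δ₂) {a b : ℝ}
    (ha : 0 ≤ a) (hb : 0 ≤ b) : δ₁ * a + δ₂ * b ≤ (δ₁ * n + δ₂ * m) * (a / n + b / m) := by
  have hn' : (0 : ℝ) < n := by exact_mod_cast hn
  have hm' : (0 : ℝ) < m := by exact_mod_cast hm
  have e : (δ₁ * n + δ₂ * m) * (a / n + b / m) =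
      δ₁ * a + δ₂ * b + (δ₁ * n * (b / m) + δ₂ * m * (a / n)) := by field_simp; ring
  rw [e]
  exact le_add_of_nonneg_right (by positivity)

/-- The numerator contributes a factor 3, and the sample denominator is at least half the population
one, giving 6. -/
theorem statB_le (hn : 1 ≤ n) (hm : 1 ≤ m) (hδ₁ : 0 ≤ δ₁) (hδ₂ : 0 ≤ δ₂) (hδ₁' : δ₁ ≤ 1 / 2)
    (hδ₂' : δ₂ ≤ 1 / 2) (hS₁ : ∀ v ∈ sparseSphere s d, 0 < quadForm S₁ v)
    (hS₂ : ∀ v ∈ sparseSphere s d, 0 < quadForm S₂ v)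
    (hx : ∀ v ∈ sparseSphere s d,
      |quadForm (sampleCov x) v - quadForm S₁ v| ≤ δ₁ * quadForm S₁ v)
    (hy : ∀ v ∈ sparseSphere s d,
      |quadForm (sampleCov y) v - quadForm S₂ v| ≤ δ₂ * quadForm S₂ v)
    {ξ : Fin n → ℝ} {η : Fin m → ℝ}
    (hξ : ∀ v ∈ sparseSphere s d, |quadForm (multiplierCov x ξ) v| ≤ 3 * δ₁ * quadForm S₁ v)
    (hη : ∀ v ∈ sparseSphere s d, |quadForm (multiplierCov y η) v| ≤ 3 * δ₂ * quadForm S₂ v) :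
    statB s x y ξ η ≤ 6 * (√(((n : ℝ) + m) / (n * m)) * (δ₁ * n + δ₂ * m)) := by
  have hn' : (0 : ℝ) < n := by exact_mod_cast hn
  have hm' : (0 : ℝ) < m := by exact_mod_cast hm
  set ρ := √(((n : ℝ) + m) / (n * m))
  refine Real.iSup_le (fun ⟨v, hv⟩ => ?_) (by positivity)
  have p₁ := hS₁ v hv
  have p₂ := hS₂ v hv
  have b₁ := abs_le.1 (hx v hv)
  have b₂ := abs_le.1 (hy v hv)
  have hw := weighted_add_le hn hm hδ₁ hδ₂ p₁.le p₂.le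
  set B := quadForm S₁ v / n + quadForm S₂ v / m with hB
  have hB0 : 0 < B := by positivity
  have hden : B / 2 ≤ quadForm (sampleCov x) v / n + quadForm (sampleCov y) v / m := by
    have e : B / 2 = (quadForm S₁ v / 2) / n + (quadForm S₂ v / 2) / m := by rw [hB]; ring
    rw [e]
    gcongr <;> nlinarith [b₁.1, b₂.1]
  rw [quadForm_pooled, quadForm_sub, abs_mul, abs_of_nonneg (Real.sqrt_nonneg _), abs_div,
    abs_of_pos (lt_of_lt_of_le (half_pos hB0) hden)]
  calc ρ * (|quadForm (multiplierCov x ξ) v - quadForm (multiplierCov y η) v| /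
        (quadForm (sampleCov x) v / n + quadForm (sampleCov y) v / m))
      ≤ ρ * (3 * ((δ₁ * n + δ₂ * m) * B) / (B / 2)) := by
        gcongr
        refine (abs_sub _ _).trans ((add_le_add (hξ v hv) (hη v hv)).trans ?_)
        linarith
    _ = _ := by field_simp; ring

theorem bootstrapQuantile_le (hα₀ : 0 < α) (hα₁ : α < 1) (hn : 1 ≤ n) (hm : 1 ≤ m)
    (hδ₁ : 0 ≤ δ₁) (hδ₂ : 0 ≤ δ₂) (hδ₁' : δ₁ ≤ 1 / 2)
    (hδ₂' : δ₂ ≤ 1 / 2) (hS₁ : ∀ v ∈ sparseSphere s d, 0 < quadForm S₁ v)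
    (hS₂ : ∀ v ∈ sparseSphere s d, 0 < quadForm S₂ v) (hx : RegularSample α δ₁ s S₁ x)
    (hy : RegularSample α δ₂ s S₂ y) :
    bootstrapQuantile α s x y ≤ 6 * (√(((n : ℝ) + m) / (n * m)) * (δ₁ * n + δ₂ * m)) := by
  -- `csInf_le` needs a lower bound: the statistic is nonnegative and 1 - α > 0, so no negative
  -- level qualifies.
  refine csInf_le ⟨0, fun t ht => ?_⟩ ?_
  · by_contra hneg
    rw [not_le] at hneg
    have hempty : {w : (Fin n → ℝ) × (Fin m → ℝ) | statB s x y w.1 w.2 ≤ t} = ∅ := by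
      refine Set.eq_empty_of_forall_notMem fun w hw => ?_
      have h0 : 0 ≤ statB s x y w.1 w.2 := Real.iSup_nonneg fun _ => abs_nonneg _
      exact absurd (h0.trans hw) (not_le.2 hneg)
    rw [Set.mem_ofPred_eq, hempty, measure_empty, nonpos_iff_eq_zero, ENNReal.ofReal_eq_zero] at ht
    linarith
  · rw [Set.mem_ofPred_eq]
    set q := 6 * (√(((n : ℝ) + m) / (n * m)) * (δ₁ * n + δ₂ * m))
    set B₁ := {ξ : Fin n → ℝ | ∃ v ∈ sparseSphere s d,
      3 * δ₁ * quadForm S₁ v < |quadForm (multiplierCov x ξ) v|} with hB₁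
    set B₂ := {η : Fin m → ℝ | ∃ v ∈ sparseSphere s d,
      3 * δ₂ * quadForm S₂ v < |quadForm (multiplierCov y η) v|} with hB₂
    have hP : IsProbabilityMeasure (multiplierLaw n m) := by unfold multiplierLaw; infer_instance
    have hcover : (Set.univ : Set ((Fin n → ℝ) × (Fin m → ℝ))) ⊆
        {w | statB s x y w.1 w.2 ≤ q} ∪ (B₁ ×ˢ Set.univ ∪ Set.univ ×ˢ B₂) := by
      rintro w -
      by_cases h₁ : w.1 ∈ B₁
      · exact Or.inr (Or.inl ⟨h₁, trivial⟩)
      by_cases h₂ : w.2 ∈ B₂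
      · exact Or.inr (Or.inr ⟨trivial, h₂⟩)
      refine Or.inl (statB_le hn hm hδ₁ hδ₂ hδ₁' hδ₂' hS₁ hS₂ hx.1 hy.1 (fun v hv => ?_)
        fun v hv => ?_)
      · by_contra hlt
        exact h₁ ⟨v, hv, not_le.1 hlt⟩
      · by_contra hlt
        exact h₂ ⟨v, hv, not_le.1 hlt⟩
    have hbad : multiplierLaw n m (B₁ ×ˢ Set.univ ∪ Set.univ ×ˢ B₂) ≤ ENNReal.ofReal α := by
      refine (measure_union_le _ _).trans ?_
      rw [multiplierLaw, Measure.prod_prod, Measure.prod_prod, measure_univ, measure_univ, mul_one,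
        one_mul]
      refine (add_le_add hx.2 hy.2).trans_eq ?_
      rw [← ENNReal.ofReal_add (by positivity) (by positivity), add_halves]
    have h := (measure_mono hcover).trans (measure_union_le (μ := multiplierLaw n m) _ _)
    rw [measure_univ] at h
    rw [ENNReal.ofReal_sub _ hα₀.le, ENNReal.ofReal_one, tsub_le_iff_right]
    exact h.trans (by gcongr)

theorem normalizedSup_le_statQ (hn : 1 ≤ n) (hm : 1 ≤ m) (hδ₁ : 0 ≤ δ₁) (hδ₂ : 0 ≤ δ₂)
    (hδ₁' : δ₁ ≤ 1 / 2)
    (hδ₂' : δ₂ ≤ 1 / 2) (hS₁ : ∀ v ∈ sparseSphere s d, 0 < quadForm S₁ v)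
    (hS₂ : ∀ v ∈ sparseSphere s d, 0 < quadForm S₂ v)
    (hx : ∀ v ∈ sparseSphere s d,
      |quadForm (sampleCov x) v - quadForm S₁ v| ≤ δ₁ * quadForm S₁ v)
    (hy : ∀ v ∈ sparseSphere s d,
      |quadForm (sampleCov y) v - quadForm S₂ v| ≤ δ₂ * quadForm S₂ v) :
    normalizedSup s n m (S₁ - S₂) S₁ S₂ ≤
      3 / 2 * statQ s x y + √(((n : ℝ) + m) / (n * m)) * (δ₁ * n + δ₂ * m) := by
  have hn' : (0 : ℝ) < n := by exact_mod_cast hn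
  have hm' : (0 : ℝ) < m := by exact_mod_cast hm
  have hQ0 : 0 ≤ statQ s x y := Real.iSup_nonneg fun _ => abs_nonneg _
  set ρ := √(((n : ℝ) + m) / (n * m)) with hρ
  have hρ0 : 0 ≤ ρ := Real.sqrt_nonneg _
  have hx0 : ∀ v ∈ sparseSphere s d, 0 < quadForm (sampleCov x) v := fun v hv => by
    nlinarith [(abs_le.1 (hx v hv)).1, hS₁ v hv]
  have hy0 : ∀ v ∈ sparseSphere s d, 0 < quadForm (sampleCov y) v := fun v hv => by
    nlinarith [(abs_le.1 (hy v hv)).1, hS₂ v hv]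
  -- Boundedness is essential: a real supremum over an unbounded set is 0 by default, and would not
  -- dominate its terms.
  have hbdd : BddAbove (Set.range fun v : sparseSphere s d =>
      |ρ * (quadForm (sampleCov x - sampleCov y) v /
        quadForm ((n : ℝ)⁻¹ • sampleCov x + (m : ℝ)⁻¹ • sampleCov y) v)|) := by
    refine ⟨ρ * (n + m), ?_⟩
    rintro _ ⟨⟨v, hv⟩, rfl⟩
    have p₁ := hx0 v hv
    have p₂ := hy0 v hv
    have hB : 0 < quadForm (sampleCov x) v / n + quadForm (sampleCov y) v / m := by positivity
    have hw := weighted_add_le (δ₁ := 1) (δ₂ := 1) hn hm zero_le_one zero_le_one p₁.le p₂.le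
    simp only [quadForm_pooled, quadForm_sub]
    rw [abs_mul, abs_of_nonneg hρ0, abs_div, abs_of_pos hB]
    gcongr
    rw [div_le_iff₀ hB]
    refine (abs_sub _ _).trans ?_
    rw [abs_of_pos p₁, abs_of_pos p₂]
    linarith
  refine Real.iSup_le (fun ⟨v, hv⟩ => ?_) (by positivity)
  have p₁ := hS₁ v hv
  have p₂ := hS₂ v hv
  have b₁ := hx v hv
  have b₂ := hy v hv
  have hle : |ρ * (quadForm (sampleCov x - sampleCov y) v /
        quadForm ((n : ℝ)⁻¹ • sampleCov x + (m : ℝ)⁻¹ • sampleCov y) v)| ≤ statQ s x y :=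
    le_ciSup hbdd ⟨v, hv⟩
  have hx0' := hx0 v hv
  have hy0' := hy0 v hv
  rw [quadForm_pooled, quadForm_sub, abs_mul, abs_of_nonneg hρ0, abs_div] at hle ⊢
  set B := quadForm S₁ v / n + quadForm S₂ v / m with hB
  set B' := quadForm (sampleCov x) v / n + quadForm (sampleCov y) v / m with hB'
  have hB0 : 0 < B := by positivity
  have hB0' : 0 < B' := by positivity
  rw [abs_of_pos hB0'] at hle
  rw [abs_of_pos hB0]
  have hBB : B' ≤ 3 / 2 * B := by
    have e : 3 / 2 * B = (3 / 2 * quadForm S₁ v) / n + (3 / 2 * quadForm S₂ v) / m := by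
      rw [hB]; ring
    rw [e, hB']
    gcongr <;> nlinarith [(abs_le.1 b₁).2, (abs_le.1 b₂).2]
  have hnum : |quadForm S₁ v - quadForm S₂ v| ≤
      |quadForm (sampleCov x) v - quadForm (sampleCov y) v| + (δ₁ * n + δ₂ * m) * B := by
    have hw := weighted_add_le hn hm hδ₁ hδ₂ p₁.le p₂.le
    rw [← hB] at hw
    have e : quadForm S₁ v - quadForm S₂ v = (quadForm (sampleCov x) v - quadForm (sampleCov y) v) +
        (-(quadForm (sampleCov x) v - quadForm S₁ v) +
          (quadForm (sampleCov y) v - quadForm S₂ v)) := by ring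
    rw [e]
    refine (abs_add_le _ _).trans (add_le_add le_rfl ((abs_add_le _ _).trans ?_))
    rw [abs_neg]
    linarith
  calc ρ * (|quadForm S₁ v - quadForm S₂ v| / B)
      ≤ ρ * ((|quadForm (sampleCov x) v - quadForm (sampleCov y) v| + (δ₁ * n + δ₂ * m) * B) / B) := by
        gcongr
    _ = ρ * (|quadForm (sampleCov x) v - quadForm (sampleCov y) v| / B) +
        ρ * (δ₁ * n + δ₂ * m) := by field_simp
    _ ≤ ρ * (3 / 2 * (|quadForm (sampleCov x) v - quadForm (sampleCov y) v| / B')) +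
        ρ * (δ₁ * n + δ₂ * m) := by
        gcongr
        rw [div_le_iff₀ hB0]
        have h0 := abs_nonneg (quadForm (sampleCov x) v - quadForm (sampleCov y) v)
        calc _ = |quadForm (sampleCov x) v - quadForm (sampleCov y) v| / B' * B' := by field_simp
          _ ≤ |quadForm (sampleCov x) v - quadForm (sampleCov y) v| / B' * (3 / 2 * B) := by gcongr
          _ = _ := by ring
    _ ≤ _ := by linarith

/-- The constant is 10 = (3/2) · 6 + 1, from the loss in `normalizedSup_le_statQ` and the bound on
the quantile. -/
theorem test_eq_one (hα₀ : 0 < α) (hα₁ : α < 1) (hn : 1 ≤ n) (hm : 1 ≤ m)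
    (hδ₁ : 0 ≤ δ₁) (hδ₂ : 0 ≤ δ₂) (hδ₁' : δ₁ ≤ 1 / 2)
    (hδ₂' : δ₂ ≤ 1 / 2) (hS₁ : ∀ v ∈ sparseSphere s d, 0 < quadForm S₁ v)
    (hS₂ : ∀ v ∈ sparseSphere s d, 0 < quadForm S₂ v) (hx : RegularSample α δ₁ s S₁ x)
    (hy : RegularSample α δ₂ s S₂ y)
    (hsep : 10 * (√(((n : ℝ) + m) / (n * m)) * (δ₁ * n + δ₂ * m)) ≤
      normalizedSup s n m (S₁ - S₂) S₁ S₂) : test α s x y = 1 := by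
  have h₁ := bootstrapQuantile_le hα₀ hα₁ hn hm hδ₁ hδ₂ hδ₁' hδ₂' hS₁ hS₂ hx hy
  have h₂ := normalizedSup_le_statQ hn hm hδ₁ hδ₂ hδ₁' hδ₂' hS₁ hS₂ hx.1 hy.1
  exact if_pos (by linarith)

end TwoSample

/-! ### Nonasymptotic lower bound on the power -/

theorem sqrt_mul_le_of_le {n m : ℕ} {κ T k : ℝ} (hn : 1 ≤ n) (hm : 1 ≤ m) (hT : 0 ≤ T)
    (hk : 0 ≤ k) (hκ : 0 ≤ κ) (hnm : (n : ℝ) ≤ κ * m) (hmn : (m : ℝ) ≤ κ * n) :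
    √(((n : ℝ) + m) / (n * m)) * (32 * T * √(k / n) * n + 32 * T * √(k / m) * m) ≤
      64 * T * √(1 + κ) * √k := by
  have hn' : (0 : ℝ) < n := by exact_mod_cast hn
  have hm' : (0 : ℝ) < m := by exact_mod_cast hm
  have h : ∀ {a b : ℝ}, 0 < a → 0 < b → a ≤ κ * b →
      √((a + b) / (a * b)) * (√(k / a) * a) ≤ √(1 + κ) * √k := by
    intro a b ha hb hab
    have e : √(k / a) * a = √(k * a) := by
      rw [show k * a = k / a * a ^ 2 by field_simp, Real.sqrt_mul (by positivity),
        Real.sqrt_sq ha.le]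
    rw [e, ← Real.sqrt_mul (by positivity), ← Real.sqrt_mul (by positivity)]
    refine Real.sqrt_le_sqrt ?_
    rw [show (a + b) / (a * b) * (k * a) = (a / b + 1) * k by field_simp]
    have : a / b ≤ κ := by rwa [div_le_iff₀ hb]
    exact mul_le_mul_of_nonneg_right (by linarith) hk
  have h₁ := h hn' hm' hnm
  have h₂ := h hm' hn' hmn
  rw [add_comm (m : ℝ), mul_comm (m : ℝ)] at h₂
  calc _ = 32 * T * (√(((n : ℝ) + m) / (n * m)) * (√(k / n) * n)) +
        32 * T * (√(((n : ℝ) + m) / (n * m)) * (√(k / m) * m)) := by ring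
    _ ≤ 32 * T * (√(1 + κ) * √k) + 32 * T * (√(1 + κ) * √k) := by gcongr
    _ = _ := by ring

theorem dataLaw_eq_map {d : ℕ} (n m : ℕ) (P₁ P₂ : Measure (Fin d → ℝ)) [IsProbabilityMeasure P₁]
    [IsProbabilityMeasure P₂] (S₁ S₂ : Matrix (Fin d) (Fin d) ℝ) :
    dataLaw n m P₁ P₂ S₁ S₂ =
      ((Measure.pi fun _ : Fin n => P₁).prod (Measure.pi fun _ : Fin m => P₂)).map
        (Prod.map (fun u i => CFC.sqrt S₁ *ᵥ u i) fun u i => CFC.sqrt S₂ *ᵥ u i) := by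
  have hmeas : ∀ S : Matrix (Fin d) (Fin d) ℝ, Measurable fun u : Fin d → ℝ => S *ᵥ u := fun S =>
    (Continuous.matrix_mulVec continuous_const continuous_id).measurable
  have hp₁ : IsProbabilityMeasure (P₁.map fun u => CFC.sqrt S₁ *ᵥ u) :=
    Measure.isProbabilityMeasure_map (hmeas _).aemeasurable
  have hp₂ : IsProbabilityMeasure (P₂.map fun u => CFC.sqrt S₂ *ᵥ u) :=
    Measure.isProbabilityMeasure_map (hmeas _).aemeasurable
  rw [dataLaw, ← Measure.pi_map_pi fun _ => (hmeas _).aemeasurable,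
    ← Measure.pi_map_pi fun _ => (hmeas _).aemeasurable, Measure.map_prod_map]
  · exact measurable_pi_lambda _ fun i => (hmeas _).comp (measurable_pi_apply i)
  · exact measurable_pi_lambda _ fun i => (hmeas _).comp (measurable_pi_apply i)

theorem measurable_sqrt_data {d : ℕ} (n m : ℕ) (S₁ S₂ : Matrix (Fin d) (Fin d) ℝ) :
    Measurable (Prod.map (fun (u : Fin n → Fin d → ℝ) i => CFC.sqrt S₁ *ᵥ u i)
      fun (u : Fin m → Fin d → ℝ) i => CFC.sqrt S₂ *ᵥ u i) := by
  have hmeas : ∀ S : Matrix (Fin d) (Fin d) ℝ, Measurable fun u : Fin d → ℝ => S *ᵥ u := fun S =>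
    (Continuous.matrix_mulVec continuous_const continuous_id).measurable
  exact (measurable_pi_lambda _ fun i => (hmeas _).comp (measurable_pi_apply i)).prodMap
    (measurable_pi_lambda _ fun i => (hmeas _).comp (measurable_pi_apply i))

/-- The bound on the probability that a sample of size `n` is not regular. -/
noncomputable def failureBound (α c T : ℝ) (L : ℝ≥0) (k : ℝ) (n : ℕ) : ℝ :=
  2 / α * (4 * Real.exp ((3 - T ^ 2 / (1600 * ((L : ℝ) + 1) ^ 4)) * k) + c / n)

theorem one_sub_le_worstPower {α : ℝ} (hα₀ : 0 < α) (hα₁ : α < 1)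
    {c : ℝ} (hc : ∀ n : ℕ, 1 ≤ n → (Measure.pi fun _ : Fin n => gaussianReal 0 1)
      (largeMultipliers n) ≤ ENNReal.ofReal (c / n)) (hc0 : 0 < c)
    {d s n m : ℕ} {L : ℝ≥0} {P₁ P₂ : Measure (Fin d → ℝ)} (hP₁ : IsSubGaussianLaw L P₁)
    (hP₂ : IsSubGaussianLaw L P₂) (hs : 1 ≤ s) (hsd : s ≤ d) (hn : 1 ≤ n) (hm : 1 ≤ m)
    (hlogn : 1 ≤ Real.log n) (hlogm : 1 ≤ Real.log m) {T κ C lam : ℝ} (hT : 0 ≤ T) (hκ : 0 ≤ κ)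
    (hnm : (n : ℝ) ≤ κ * m) (hmn : (m : ℝ) ≤ κ * n)
    (hTn : 4096 * T ^ 2 * (sparseDim s d * Real.log n) ≤ n)
    (hTm : 4096 * T ^ 2 * (sparseDim s d * Real.log m) ≤ m)
    (hlam : 640 * T * √(1 + κ) ≤ lam) :
    1 - ENNReal.ofReal (failureBound α c T L (sparseDim s d) n +
      failureBound α c T L (sparseDim s d) m) ≤ worstPower α C lam s n m P₁ P₂ := by
  have := hP₁.isProbabilityMeasure
  have := hP₂.isProbabilityMeasure
  have hk0 : 0 ≤ sparseDim s d := zero_le_one.trans (one_le_sparseDim hs hsd)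
  set k := sparseDim s d with hk
  refine le_iInf₂ fun S hS => ?_
  obtain ⟨⟨hS₁, hmin₁, -⟩, ⟨hS₂, hmin₂, -⟩, hsep⟩ := hS
  -- One assumption serves two purposes: 4096 = 4 · 32² makes the relative error at most 1/2 because
  -- log j ≥ 1, and it also covers the Chernoff range condition.
  have hδ : ∀ {j : ℕ}, 1 ≤ j → 1 ≤ Real.log j → 4096 * T ^ 2 * (k * Real.log j) ≤ j →
      32 * T * √(k / j) ≤ 1 / 2 ∧ T ^ 2 * (4 * Real.log j) * k ≤ j := by
    intro j hj hlog h
    have hj' : (0 : ℝ) < j := by exact_mod_cast hj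
    have h0 : 0 ≤ T ^ 2 * k := by positivity
    constructor
    · refine abs_le_of_sq_le_sq' ?_ (by norm_num) |>.2
      rw [mul_pow, Real.sq_sqrt (by positivity), mul_div_assoc', div_le_iff₀ hj']
      nlinarith
    · nlinarith
  obtain ⟨hδn, hTn'⟩ := hδ hn hlogn hTn
  obtain ⟨hδm, hTm'⟩ := hδ hm hlogm hTm
  have h₁ := hP₁.measure_not_regularSample_le hα₀ hα₁ hc hc0 hS₁ hs hsd hn hlogn hT hTn'
  have h₂ := hP₂.measure_not_regularSample_le hα₀ hα₁ hc hc0 hS₂ hs hsd hm hlogm hT hTm'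
  rw [← hk] at h₁ h₂
  rw [dataLaw_eq_map]
  -- This inequality holds for arbitrary sets, so measurability of the rejection event is not
  -- needed.
  refine le_trans ?_ (Measure.le_map_apply (measurable_sqrt_data n m S.1 S.2).aemeasurable _)
  set μ₁ := Measure.pi fun _ : Fin n => P₁
  set μ₂ := Measure.pi fun _ : Fin m => P₂
  set B₁ := {u : Fin n → Fin d → ℝ | ¬ RegularSample α (32 * T * √(k / n)) s S.1
    fun i => CFC.sqrt S.1 *ᵥ u i} with hB₁
  set B₂ := {u : Fin m → Fin d → ℝ | ¬ RegularSample α (32 * T * √(k / m)) s S.2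
    fun i => CFC.sqrt S.2 *ᵥ u i} with hB₂
  rw [tsub_le_iff_right]
  have hcover : (Set.univ : Set ((Fin n → Fin d → ℝ) × (Fin m → Fin d → ℝ))) ⊆
      (Prod.map (fun u i => CFC.sqrt S.1 *ᵥ u i) fun u i => CFC.sqrt S.2 *ᵥ u i) ⁻¹'
        {z | test α s z.1 z.2 = 1} ∪ (B₁ ×ˢ Set.univ ∪ Set.univ ×ˢ B₂) := by
    rintro u -
    by_cases hu₁ : u.1 ∈ B₁
    · exact Or.inr (Or.inl ⟨hu₁, trivial⟩)
    by_cases hu₂ : u.2 ∈ B₂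
    · exact Or.inr (Or.inr ⟨trivial, hu₂⟩)
    refine Or.inl (test_eq_one hα₀ hα₁ hn hm (by positivity) (by positivity) hδn hδm
      (fun v hv => quadForm_pos_of_sparseMinEig_pos hS₁ hmin₁ hv)
      (fun v hv => quadForm_pos_of_sparseMinEig_pos hS₂ hmin₂ hv) (not_not.1 hu₁) (not_not.1 hu₂)
      (le_trans ?_ hsep))
    have h := sqrt_mul_le_of_le hn hm hT hk0 hκ hnm hmn
    change _ ≤ lam * √k
    calc _ ≤ 10 * (64 * T * √(1 + κ) * √k) := by gcongr
      _ = 640 * T * √(1 + κ) * √k := by ring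
      _ ≤ _ := by gcongr
  have h := (measure_mono hcover).trans (measure_union_le (μ := μ₁.prod μ₂) _ _)
  rw [measure_univ] at h
  refine h.trans (add_le_add le_rfl ((measure_union_le _ _).trans ?_))
  rw [Measure.prod_prod, Measure.prod_prod, measure_univ, measure_univ, mul_one, one_mul]
  refine (add_le_add h₁ h₂).trans_eq ?_
  rw [failureBound, failureBound, ENNReal.ofReal_add (by positivity) (by positivity)]

theorem quadForm_smul_one {d s : ℕ} (a : ℝ) (v : sparseSphere s d) :
    quadForm (a • (1 : Matrix (Fin d) (Fin d) ℝ)) v = a := by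
  have hv : (v : Fin d → ℝ) ⬝ᵥ v = 1 := by simpa [dotProduct, sq] using v.2.1
  rw [quadForm_smul, quadForm_one, hv, mul_one]

/-- An infimum over the empty set is ∞ in `ℝ≥0∞`, so convergence of the power to 1 requires a member
of the class. The pair ((n+1)I, I) has condition numbers 1 and a gap of at least √n/3, eventually
larger than λ√k. -/
theorem altClass_nonempty {d s n m : ℕ} {C lam : ℝ} (hC : 1 ≤ C) (hs : 1 ≤ s) (hsd : s ≤ d)
    (hn : 1 ≤ n) (hm : 1 ≤ m) (h : 9 * lam ^ 2 * sparseDim s d ≤ n) :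
    (altClass (d := d) C lam s n m).Nonempty := by
  have hn' : (1 : ℝ) ≤ n := by exact_mod_cast hn
  have hm' : (1 : ℝ) ≤ m := by exact_mod_cast hm
  have hne : Nonempty (sparseSphere s d) := (sparseSphere_nonempty hs hsd).to_subtype
  have hk0 : 0 ≤ sparseDim s d := zero_le_one.trans (one_le_sparseDim hs hsd)
  have hmin : ∀ a : ℝ, sparseMinEig s (a • (1 : Matrix (Fin d) (Fin d) ℝ)) = a := fun a => by
    simp only [sparseMinEig, quadForm_smul_one, ciInf_const]
  have hmax : ∀ a : ℝ, sparseMaxEig s (a • (1 : Matrix (Fin d) (Fin d) ℝ)) = a := fun a => by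
    simp only [sparseMaxEig, quadForm_smul_one, ciSup_const]
  have hcond : ∀ a : ℝ, 0 < a → (a • (1 : Matrix (Fin d) (Fin d) ℝ)).PosSemidef ∧
      0 < sparseMinEig s (a • (1 : Matrix (Fin d) (Fin d) ℝ)) ∧
      sparseMaxEig s (a • (1 : Matrix (Fin d) (Fin d) ℝ)) /
        sparseMinEig s (a • (1 : Matrix (Fin d) (Fin d) ℝ)) ≤ C := fun a ha => by
    rw [hmin, hmax, div_self ha.ne']
    exact ⟨Matrix.PosSemidef.one.smul ha.le, ha, hC⟩
  refine ⟨(((n : ℝ) + 1) • 1, (1 : ℝ) • 1), hcond _ (by positivity), hcond _ one_pos, ?_⟩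
  simp only [normalizedSup, quadForm_sub, quadForm_pooled, quadForm_smul_one, ciSup_const]
  change lam * √(sparseDim s d) ≤ _
  have h₁ : lam * √(sparseDim s d) ≤ √n / 3 := by
    rw [le_div_iff₀ (by norm_num)]
    refine Real.le_sqrt_of_sq_le ?_
    calc (lam * √(sparseDim s d) * 3) ^ 2 = 9 * lam ^ 2 * √(sparseDim s d) ^ 2 := by ring
      _ ≤ (n : ℝ) := by rwa [Real.sq_sqrt hk0]
  have h₂ : √(1 / n) ≤ √(((n : ℝ) + m) / (n * m)) := by
    refine Real.sqrt_le_sqrt ?_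
    rw [div_le_div_iff₀ (by positivity) (by positivity)]
    nlinarith
  have h₃ : (n : ℝ) / 3 ≤ (n + 1 - 1) / ((n + 1) / n + 1 / m) := by
    rw [add_sub_cancel_right]
    gcongr
    have e₁ : ((n : ℝ) + 1) / n ≤ 2 := by rw [div_le_iff₀ (by positivity)]; linarith
    have e₂ : (1 : ℝ) / m ≤ 1 := by rw [div_le_iff₀ (by positivity)]; linarith
    linarith
  refine h₁.trans (le_trans ?_ (le_abs_self _))
  calc √(n : ℝ) / 3 = √(1 / n) * (n / 3) := by
        rw [Real.sqrt_div zero_le_one, Real.sqrt_one]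
        have : (n : ℝ) = √n * √n := (Real.mul_self_sqrt (by positivity)).symm
        have h0 : √(n : ℝ) ≠ 0 := by positivity
        field_simp
        rw [Real.sq_sqrt (by positivity)]
    _ ≤ _ := by gcongr

theorem worstPower_le_one {d s n m : ℕ} {α C lam : ℝ} {L : ℝ≥0} {P₁ P₂ : Measure (Fin d → ℝ)}
    (hP₁ : IsSubGaussianLaw L P₁) (hP₂ : IsSubGaussianLaw L P₂)
    (h : (altClass (d := d) C lam s n m).Nonempty) : worstPower α C lam s n m P₁ P₂ ≤ 1 := by
  obtain ⟨S, hS⟩ := h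
  have := hP₁.isProbabilityMeasure
  have := hP₂.isProbabilityMeasure
  have hp : IsProbabilityMeasure (dataLaw n m P₁ P₂ S.1 S.2) := by
    rw [dataLaw_eq_map]
    exact Measure.isProbabilityMeasure_map (measurable_sqrt_data n m S.1 S.2).aemeasurable
  exact (iInf₂_le S hS).trans prob_le_one

/-! ### Asymptotics -/

section Asymptotics

variable {m d s : ℕ → ℕ} {κ : ℝ}

theorem tendsto_sampleSize_atTop (hκ : 0 < κ) (h : ∀ᶠ n : ℕ in atTop, (n : ℝ) ≤ κ * m n) :
    Tendsto m atTop atTop := by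
  have h₁ : Tendsto (fun n : ℕ => (n : ℝ) / κ) atTop atTop :=
    tendsto_natCast_atTop_atTop.atTop_div_const hκ
  refine tendsto_natCast_atTop_iff.1 (tendsto_atTop_mono' atTop ?_ h₁)
  filter_upwards [h] with n hn
  rw [div_le_iff₀ hκ]
  linarith

theorem eventually_sparseDim_mul_log_le
    (h : (fun n : ℕ => sparseDim (s n) (d n) * Real.log n) =o[atTop] fun n : ℕ => (n : ℝ))
    (a : ℝ) : ∀ᶠ n : ℕ in atTop, a * (sparseDim (s n) (d n) * Real.log n) ≤ n := by
  filter_upwards [h.def (c := (|a| + 1)⁻¹) (by positivity)] with n hn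
  rw [Real.norm_eq_abs, Real.norm_eq_abs, Nat.abs_cast, inv_mul_eq_div,
    le_div_iff₀ (by positivity)] at hn
  have h₁ := abs_mul a (sparseDim (s n) (d n) * Real.log n)
  have h₂ := le_abs_self (a * (sparseDim (s n) (d n) * Real.log n))
  have h₃ := abs_nonneg (sparseDim (s n) (d n) * Real.log n)
  nlinarith

theorem eventually_one_le_log : ∀ᶠ n : ℕ in atTop, 1 ≤ Real.log n :=
  (Real.tendsto_log_atTop.comp tendsto_natCast_atTop_atTop).eventually_ge_atTop 1

theorem eventually_one_sub_le_worstPower {α : ℝ} (hα₀ : 0 < α) (hα₁ : α < 1)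
    {c : ℝ} (hc : ∀ n : ℕ, 1 ≤ n → (Measure.pi fun _ : Fin n => gaussianReal 0 1)
      (largeMultipliers n) ≤ ENNReal.ofReal (c / n)) (hc0 : 0 < c) {L : ℝ≥0} {A C lam : ℝ}
    (hA : 0 ≤ A) (hκ : 1 ≤ κ)
    (hlam : 640 * (40 * ((L : ℝ) + 1) ^ 2 * √(A + 3)) * √(1 + κ) ≤ lam)
    {P₁ P₂ : ∀ n, Measure (Fin (d n) → ℝ)}
    (hm : ∀ᶠ n : ℕ in atTop, (n : ℝ) ≤ κ * m n ∧ (m n : ℝ) ≤ κ * n)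
    (hsd : ∀ n, 1 ≤ s n ∧ s n ≤ d n)
    (hk : (fun n : ℕ => sparseDim (s n) (d n) * Real.log n) =o[atTop] fun n : ℕ => (n : ℝ))
    (hP : ∀ n, IsSubGaussianLaw L (P₁ n) ∧ IsSubGaussianLaw L (P₂ n)) :
    ∀ᶠ n : ℕ in atTop, 1 - ENNReal.ofReal (2 / α *
      (8 * Real.exp (-(A * sparseDim (s n) (d n))) + 2 * κ * c / n)) ≤
        worstPower α C lam (s n) n (m n) (P₁ n) (P₂ n) := by
  have hκ0 : 0 < κ := by linarith
  -- Chosen so that T²/(1600 (L+1)⁴) = A + 3, which beats the entropy 3 and leaves the exponent -A.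
  set T := 40 * ((L : ℝ) + 1) ^ 2 * √(A + 3) with hT
  have hT0 : 0 ≤ T := by positivity
  have hexp : 3 - T ^ 2 / (1600 * ((L : ℝ) + 1) ^ 4) = -A := by
    have : T ^ 2 = 1600 * ((L : ℝ) + 1) ^ 4 * (A + 3) := by
      rw [hT, mul_pow, Real.sq_sqrt (by linarith)]; ring
    rw [this, mul_div_cancel_left₀ _ (by positivity)]
    ring
  have hmtop := tendsto_sampleSize_atTop hκ0 (hm.mono fun n h => h.1)
  have hlogκ : ∀ᶠ n : ℕ in atTop, Real.log κ ≤ Real.log n :=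
    (Real.tendsto_log_atTop.comp tendsto_natCast_atTop_atTop).eventually_ge_atTop _
  filter_upwards [hm, eventually_ge_atTop 1, hmtop.eventually_ge_atTop 1, eventually_one_le_log,
    hmtop.eventually eventually_one_le_log, hlogκ,
    eventually_sparseDim_mul_log_le hk (4096 * T ^ 2),
    eventually_sparseDim_mul_log_le hk (8192 * T ^ 2 * κ)]
    with n ⟨hnm, hmn⟩ hn1 hm1 hlogn hlogm hlogκ hTn hTκ
  have hn' : (0 : ℝ) < n := by exact_mod_cast hn1
  have hm' : (0 : ℝ) < m n := by exact_mod_cast hm1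
  have hk0 : 0 ≤ sparseDim (s n) (d n) :=
    zero_le_one.trans (one_le_sparseDim (hsd n).1 (hsd n).2)
  -- From m ≤ κn and log κ ≤ log n. This doubling, together with n ≤ κm, explains the constant 8192
  -- κ = 2 · 4096 κ.
  have hlogm2 : Real.log (m n) ≤ 2 * Real.log n := by
    have := Real.log_le_log hm' hmn
    rw [Real.log_mul hκ0.ne' hn'.ne'] at this
    linarith
  have hTm : 4096 * T ^ 2 * (sparseDim (s n) (d n) * Real.log (m n)) ≤ m n := by
    have h₁ : κ * (4096 * T ^ 2 * (sparseDim (s n) (d n) * Real.log (m n))) ≤ κ * m n :=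
      calc _ ≤ κ * (4096 * T ^ 2 * (sparseDim (s n) (d n) * (2 * Real.log n))) := by gcongr
        _ = 8192 * T ^ 2 * κ * (sparseDim (s n) (d n) * Real.log n) := by ring
        _ ≤ _ := hTκ.trans hnm
    exact le_of_mul_le_mul_left h₁ hκ0
  refine le_trans (tsub_le_tsub_left (ENNReal.ofReal_le_ofReal ?_) 1)
    (one_sub_le_worstPower hα₀ hα₁ hc hc0 (hP n).1 (hP n).2 (hsd n).1 (hsd n).2 hn1 hm1 hlogn hlogm
      hT0 hκ0.le hnm hmn hTn hTm hlam)
  rw [failureBound, failureBound, hexp, ← mul_add, ← neg_mul]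
  gcongr 2 / α * ?_
  have h₁ : c / n ≤ κ * c / n := by gcongr; nlinarith
  have h₂ : c / m n ≤ κ * c / n := by
    rw [div_le_div_iff₀ hm' hn']
    nlinarith
  have h₃ : 2 * κ * c / n = κ * c / n + κ * c / n := by ring
  linarith

end Asymptotics

end SparseRoy

theorem mainTheorem6 (α C κ : ℝ) (L : ℝ≥0) (hα₀ : 0 < α) (hα₁ : α < 1) (hC : 1 ≤ C) :
    (∃ lam₀ : ℝ, 0 < lam₀ ∧ ∀ lam : ℝ, lam₀ ≤ lam →
      ∀ (m d s : ℕ → ℕ) (P₁ P₂ : ∀ n, Measure (Fin (d n) → ℝ)),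
        (∀ᶠ n : ℕ in atTop, (n : ℝ) ≤ κ * m n ∧ (m n : ℝ) ≤ κ * n) →
        (∀ n, 1 ≤ s n ∧ s n ≤ d n) →
        ((fun n : ℕ => (s n : ℝ) * Real.log (Real.exp 1 * d n / s n) * Real.log n)
          =o[atTop] fun n : ℕ => (n : ℝ)) →
        (∀ n, SparseRoy.IsSubGaussianLaw L (P₁ n) ∧ SparseRoy.IsSubGaussianLaw L (P₂ n)) →
        Tendsto d atTop atTop →
        Tendsto (fun n : ℕ => SparseRoy.worstPower α C lam (s n) n (m n) (P₁ n) (P₂ n))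
          atTop (𝓝 1)) ∧
    (∀ ε : ℝ, 0 < ε → ∃ lam₀ : ℝ, 0 < lam₀ ∧ ∀ lam : ℝ, lam₀ ≤ lam →
      ∀ (m d s : ℕ → ℕ) (P₁ P₂ : ∀ n, Measure (Fin (d n) → ℝ)),
        (∀ᶠ n : ℕ in atTop, (n : ℝ) ≤ κ * m n ∧ (m n : ℝ) ≤ κ * n) →
        (∀ n, 1 ≤ s n ∧ s n ≤ d n) →
        ((fun n : ℕ => (s n : ℝ) * Real.log (Real.exp 1 * d n / s n) * Real.log n)
          =o[atTop] fun n : ℕ => (n : ℝ)) →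
        (∀ n, SparseRoy.IsSubGaussianLaw L (P₁ n) ∧ SparseRoy.IsSubGaussianLaw L (P₂ n)) →
        ∀ᶠ n : ℕ in atTop, ENNReal.ofReal (1 - ε) ≤
          SparseRoy.worstPower α C lam (s n) n (m n) (P₁ n) (P₂ n)) := by
  obtain ⟨c, hc0, hc⟩ := SparseRoy.exists_measure_largeMultipliers_le
  -- Enlarging κ to at least 1 preserves the balance condition and lets κc/n dominate both c/n and
  -- c/m.
  have hκ1 : 1 ≤ max κ 1 := le_max_right _ _
  have hmax : ∀ m : ℕ → ℕ, (∀ᶠ n : ℕ in atTop, (n : ℝ) ≤ κ * m n ∧ (m n : ℝ) ≤ κ * n) →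
      ∀ᶠ n : ℕ in atTop, (n : ℝ) ≤ max κ 1 * m n ∧ (m n : ℝ) ≤ max κ 1 * n := fun m h =>
    h.mono fun n hn => ⟨hn.1.trans (by gcongr; exact le_max_left _ _),
      hn.2.trans (by gcongr; exact le_max_left _ _)⟩
  have hlim : Tendsto (fun n : ℕ => 2 * max κ 1 * c / n) atTop (𝓝 0) :=
    tendsto_const_nhds.div_atTop tendsto_natCast_atTop_atTop
  -- Here A = 1 suffices, since exp(-k) already tends to 0 as d grows. The factor 640 is 10 · 64,
  -- from `test_eq_one` and `sqrt_mul_le_of_le`.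
  refine ⟨⟨640 * (40 * ((L : ℝ) + 1) ^ 2 * √(1 + 3)) * √(1 + max κ 1), by positivity,
    fun lam hlam m d s P₁ P₂ hm hsd hk hP hd => ?_⟩, fun ε hε => ?_⟩
  · have hlow := SparseRoy.eventually_one_sub_le_worstPower (C := C) hα₀ hα₁ hc hc0 zero_le_one hκ1
      hlam (hmax m hm) hsd hk hP
    have hup : ∀ᶠ n : ℕ in atTop,
        SparseRoy.worstPower α C lam (s n) n (m n) (P₁ n) (P₂ n) ≤ 1 := by
      filter_upwards [eventually_ge_atTop 1, SparseRoy.eventually_one_le_log,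
        (SparseRoy.tendsto_sampleSize_atTop (zero_lt_one.trans_le hκ1)
          ((hmax m hm).mono fun n h => h.1)).eventually_ge_atTop 1,
        SparseRoy.eventually_sparseDim_mul_log_le hk (9 * lam ^ 2)] with n hn hlog hm1 hkn
      refine SparseRoy.worstPower_le_one (hP n).1 (hP n).2
        (SparseRoy.altClass_nonempty hC (hsd n).1 (hsd n).2 hn hm1 (le_trans ?_ hkn))
      have hk0 := SparseRoy.one_le_sparseDim (hsd n).1 (hsd n).2
      gcongr
      nlinarith
    have hexp : Tendsto (fun n => Real.exp (-(1 * SparseRoy.sparseDim (s n) (d n)))) atTop (𝓝 0) := by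
      refine Real.tendsto_exp_neg_atTop_nhds_zero.comp ?_
      simp only [one_mul]
      refine tendsto_atTop_mono (fun n => ?_)
        (Real.tendsto_log_atTop.comp (tendsto_natCast_atTop_atTop.comp hd))
      have := SparseRoy.one_add_log_le_sparseDim (hsd n).1 (hsd n).2
      simp only [Function.comp_apply]
      linarith
    have hbound : Tendsto (fun n : ℕ => 1 - ENNReal.ofReal (2 / α *
        (8 * Real.exp (-(1 * SparseRoy.sparseDim (s n) (d n))) + 2 * max κ 1 * c / n)))
        atTop (𝓝 1) := by
      have h₁ := ((hexp.const_mul 8).add hlim).const_mul (2 / α)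
      simp only [mul_zero, add_zero] at h₁
      have h₂ := ENNReal.tendsto_ofReal h₁
      rw [ENNReal.ofReal_zero] at h₂
      simpa using ENNReal.Tendsto.sub (tendsto_const_nhds (x := (1 : ℝ≥0∞))) h₂
        (Or.inl ENNReal.one_ne_top)
    exact tendsto_of_tendsto_of_tendsto_of_le_of_le' hbound tendsto_const_nhds hlow hup
  -- With d possibly bounded only k ≥ 1 is available, so A itself must make the exponential term at
  -- most ε/2.
  · obtain ⟨A, hA0, hA⟩ : ∃ A : ℝ, 0 ≤ A ∧ 2 / α * (8 * Real.exp (-A)) ≤ ε / 2 := by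
      have h := (Real.tendsto_exp_neg_atTop_nhds_zero.const_mul 8).const_mul (2 / α)
      simp only [mul_zero] at h
      obtain ⟨A, h₁, h₂⟩ := ((h.eventually_le_const (half_pos hε)).and
        (eventually_ge_atTop 0)).exists
      exact ⟨A, h₂, h₁⟩
    refine ⟨640 * (40 * ((L : ℝ) + 1) ^ 2 * √(A + 3)) * √(1 + max κ 1), by positivity,
      fun lam hlam m d s P₁ P₂ hm hsd hk hP => ?_⟩
    have hlim' := hlim.const_mul (2 / α)
    rw [mul_zero] at hlim'
    filter_upwards [SparseRoy.eventually_one_sub_le_worstPower (C := C) hα₀ hα₁ hc hc0 hA0 hκ1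
      hlam (hmax m hm) hsd hk hP, hlim'.eventually_le_const (half_pos hε)] with n hn hn'
    refine le_trans ?_ hn
    rw [ENNReal.ofReal_sub _ hε.le, ENNReal.ofReal_one]
    refine tsub_le_tsub_left (ENNReal.ofReal_le_ofReal ?_) 1
    have hk1 := SparseRoy.one_le_sparseDim (hsd n).1 (hsd n).2
    have hexp : Real.exp (-(A * SparseRoy.sparseDim (s n) (d n))) ≤ Real.exp (-A) := by
      gcongr
      nlinarith
    calc _ = 2 / α * (8 * Real.exp (-(A * SparseRoy.sparseDim (s n) (d n)))) +
          2 / α * (2 * max κ 1 * c / n) := by ring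
      _ ≤ 2 / α * (8 * Real.exp (-A)) + 2 / α * (2 * max κ 1 * c / n) := by gcongr
      _ ≤ ε := by linarith
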